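/- Let $k\ge 4$ and let $V$ be the complex vector space of vectors indexed by the perfect matchings of the complete graph $K_{2k}$ on the vertex set $\{1,\dots,2k\}$, regarded as a $\mathrm{Sym}(2k)$-module through the natural action of $\mathrm{Sym}(2k)$ on perfect matchings. For a partition $\lambda$ of $2k$ let $[\lambda]\subseteq V$ denote the sum of all submodules of $V$ isomorphic to the irreducible (Specht) module of $\mathrm{Sym}(2k)$ corresponding to $\lambda$. For a subset $S\subset\{1,\dots,2k\}$ with $|S|=4$ let $w_S\in V$ be the characteristic vector of the set of all perfect matchings that contain two edges $e,e'$ which form a set partition of $S$. Then the submodules $[2k]$, $[2k-2,2]$ and $[2k-4,4]$ of $V$ are irreducible, their sum is direct, and $$\operatorname{span}_{\mathbb C}\{\,w_S : S\subset\{1,\dots,2k\},\ |S|=4\,\} \;=\; [2k]\oplus[2k-2,2]\oplus[2k-4,4].$$ -/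

import Mathlib

/-! ### Specht modules -/

namespace SymModule

/-- The Young diagram with a single row of length `a`, i.e. the partition `[a]`. -/
def oneRow (a : ℕ) : YoungDiagram :=
  YoungDiagram.ofRowLens [a] (by
    rw [List.sortedGE_iff_pairwise]
    simp)

/-- The Young diagram with rows of lengths `a ≥ b`, i.e. the partition `[a, b]`. -/
def twoRow (a b : ℕ) (h : b ≤ a) : YoungDiagram :=
  YoungDiagram.ofRowLens [a, b] (by
    rw [List.sortedGE_iff_pairwise]
    simpa using h)

/-- A (bijective) Young tableau of shape `μ` with entries in `Fin n`: the entry `x` is placed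
in the cell `T x`. -/
abbrev Tableau (n : ℕ) (μ : YoungDiagram) : Type := Fin n ≃ μ.cells

/-- The complex group algebra of the symmetric group of degree `n`. -/
abbrev GroupAlg (n : ℕ) : Type := MonoidAlgebra ℂ (Equiv.Perm (Fin n))

/-- The sum, in the group algebra, of all permutations preserving every row of `T`. -/
noncomputable def rowSum {n : ℕ} {μ : YoungDiagram} (T : Tableau n μ) : GroupAlg n :=
  ∑ σ : Equiv.Perm (Fin n) with ∀ x, (T (σ x)).1.1 = (T x).1.1,
    MonoidAlgebra.single σ (1 : ℂ)

/-- The signed sum, in the group algebra, of all permutations preserving every column of `T`. -/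
noncomputable def colSum {n : ℕ} {μ : YoungDiagram} (T : Tableau n μ) : GroupAlg n :=
  ∑ σ : Equiv.Perm (Fin n) with ∀ x, (T (σ x)).1.2 = (T x).1.2,
    MonoidAlgebra.single σ ((Equiv.Perm.sign σ : ℤ) : ℂ)

/-- The Specht module of the tableau `T` of shape `μ`, as the left ideal of the group algebra
generated by the Young symmetrizer of `T`. Up to isomorphism it depends only on `μ`, and it is
the irreducible module of the symmetric group that corresponds to the partition `μ`; for
`μ = [n]` it is the trivial module. -/
noncomputable def specht {n : ℕ} {μ : YoungDiagram} (T : Tableau n μ) :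
    Submodule (GroupAlg n) (GroupAlg n) :=
  Submodule.span (GroupAlg n) {colSum T * rowSum T}

/-! ### Perfect matchings of the complete graph on `2k` vertices -/

/-- The perfect matchings of the complete graph `K_{2k}`. -/
def PerfMatching (k : ℕ) : Type :=
  {M : (⊤ : SimpleGraph (Fin (2 * k))).Subgraph // M.IsPerfectMatching}

/-- The automorphism of the complete graph given by a permutation of its vertices. -/
def permIso {V : Type*} (σ : Equiv.Perm V) : (⊤ : SimpleGraph V) ≃g (⊤ : SimpleGraph V) :=
  SimpleGraph.Iso.completeGraph σ

/-- The natural action of the symmetric group on perfect matchings: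
`{a, b}` is an edge of `M` if and only if `{σ a, σ b}` is an edge of `σ • M`. -/
instance (k : ℕ) : MulAction (Equiv.Perm (Fin (2 * k))) (PerfMatching k) where
  smul σ M := ⟨M.1.map (permIso σ).toHom,
    M.2.1.map _ (permIso σ).injective, fun v => ⟨σ.symm v, M.2.2 _, σ.apply_symm_apply v⟩⟩
  one_smul M := Subtype.ext M.1.map_id
  mul_smul σ τ M := Subtype.ext (M.1.map_comp (permIso τ).toHom (permIso σ).toHom)

/-- The permutation representation of the symmetric group on the complex vectors indexed by
the perfect matchings of `K_{2k}`. -/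
def matchingRep (k : ℕ) :
    Representation ℂ (Equiv.Perm (Fin (2 * k))) (PerfMatching k → ℂ) where
  toFun σ :=
    { toFun := fun f M => f (σ⁻¹ • M)
      map_add' := fun _ _ => rfl
      map_smul' := fun _ _ => rfl }
  map_one' := by ext f M; simp
  map_mul' σ τ := by ext f M; simp [mul_smul]

/-- The space of complex vectors indexed by the perfect matchings of `K_{2k}`, as a module over
the group algebra of the symmetric group. -/
abbrev MatchingSpace (k : ℕ) : Type := (matchingRep k).asModule

/-- The part of the matching space belonging to the partition `μ` of `2k`: the sum of all of
its submodules that are isomorphic to the Specht module of shape `μ` (i.e. to the Specht module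
of some tableau of shape `μ`). The matching space is a multiplicity-free module, so this is
the irreducible submodule denoted by the partition `μ`, whenever `μ` occurs. -/
noncomputable def constituent (k : ℕ) (μ : YoungDiagram) :
    Submodule (GroupAlg (2 * k)) (MatchingSpace k) :=
  ⨆ T : Tableau (2 * k) μ, isotypicComponent (GroupAlg (2 * k)) (MatchingSpace k) (specht T)

/-- The perfect matching `M` covers the set `S` by two of its edges: `S` is partitioned by
two edges `{a, b}` and `{c, d}` of `M`. (Intended for sets `S` with four elements.) -/
def CoversByTwo {k : ℕ} (M : PerfMatching k) (S : Finset (Fin (2 * k))) : Prop :=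
  ∃ a b c d, S = {a, b, c, d} ∧ M.1.Adj a b ∧ M.1.Adj c d

/-- The characteristic vector `w_S` of the set of perfect matchings covering `S` by two edges. -/
noncomputable def w {k : ℕ} (S : Finset (Fin (2 * k))) : MatchingSpace k :=
  (matchingRep k).asModuleEquiv.symm (Set.indicator {M | CoversByTwo M S} 1)

end SymModule

/-! For a vertex set `P` let `closedVec P` be the indicator of the matchings in which `P` is a union
of edges. It is the all-ones vector for `P = ∅`, an edge indicator for two points, and `w P` for
four points. Let `W j` be the span of these vectors over all sets of size `j`. For j = 0, 2, 4 the
constituent of shape [2k-j, j] is what `W j` adds to the smaller spans.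

Fix a tableau of that shape with second row `R`, row sum `a` and signed column sum `b`. A vector
fixed by the setwise stabilizer of `R` depends only on how many vertices of `R` have their partner
in `R` (`exists_smul_eq`). For |R| ≤ 4 this makes it a multiple of `closedVec R` modulo smaller sets
(`exists_sub_smul_mem_closedSpan`). Since `b` kills the vectors of smaller sets, `b * a` maps the
whole space into the line of the polytabloid `b • closedVec R`. This gives multiplicity at most one.
A positivity argument with the invariant Hermitian form shows that `b * a` is nonzero on this line,
so the polytabloid generates the isotypic component, which is simple (`isotypicComponent_span_eq`).
The same nonvanishing recovers `closedVec R` from the polytabloid modulo smaller sets.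

Hence the three constituents split the filtration W 0 ≤ W 0 + W 2 ≤ W 0 + W 2 + W 4. Summing
`closedVec S` over the four-sets `S` containing a given `P` puts W 0 and W 2 inside W 4, so W 4 is
the whole sum. -/

namespace SymModule

/-! ### Left ideals generated by quasi-idempotents -/

section Algebra

variable {A V : Type*} [Ring A] [Algebra ℂ A] [AddCommGroup V] [Module ℂ V] [Module A V]
  [IsScalarTower ℂ A V]

/-- Split the regular module as `N ⊔ Q` and write 1 = f + q accordingly; right multiplication by f
is the identity on `N`. If `e` does not kill `N`, some `e * y * e` is a nonzero multiple of `e`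
lying in `N`, so `e ∈ N`. If `e` kills `N`, then `e * f = 0`, and every `y * e` in `N` equals `y * e
* f = 0`. -/
theorem isSimpleModule_span_of_mul_mul [IsSemisimpleRing A] {e : A} (he : e ≠ 0)
    (h : ∀ x, ∃ t : ℂ, e * x * e = t • e) :
    IsSimpleModule A (Submodule.span A {e}) := by
  rw [isSimpleModule_iff_isAtom]
  refine ⟨by simpa using he, fun N hN => ?_⟩
  obtain ⟨Q, hQ⟩ := exists_isCompl N
  obtain ⟨f, hf, q, hq, hfq⟩ := Submodule.mem_sup.1
    (hQ.sup_eq_top ▸ Submodule.mem_top : (1 : A) ∈ N ⊔ Q)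
  by_cases hN0 : ∃ x ∈ N, e * x ≠ 0
  · obtain ⟨x, hx, hex⟩ := hN0
    exfalso
    refine hN.not_ge ?_
    obtain ⟨y, rfl⟩ := Submodule.mem_span_singleton.1 (hN.le hx)
    obtain ⟨t, ht⟩ := h y
    rw [smul_eq_mul, ← mul_assoc, ht] at hex
    have ht0 : t ≠ 0 := by rintro rfl; simp at hex
    rw [Submodule.span_singleton_le_iff_mem]
    have : e = (algebraMap ℂ A t⁻¹ * e) • (y • e) := by
      rw [smul_eq_mul, smul_eq_mul, mul_assoc, ← mul_assoc e, ht, ← Algebra.smul_def, smul_smul,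
        inv_mul_cancel₀ ht0, one_smul]
    rw [this]
    exact N.smul_mem _ hx
  · push Not at hN0
    have hff : ∀ x ∈ N, x * f = x := by
      intro x hx
      have h1 : x * f + x * q = x := by rw [← mul_add, hfq, mul_one]
      have h2 : x * q ∈ N ⊓ Q :=
        ⟨by rw [eq_sub_of_add_eq' h1]; exact N.sub_mem hx (N.smul_mem x hf), Q.smul_mem x hq⟩
      rw [hQ.inf_eq_bot, Submodule.mem_bot] at h2
      rwa [h2, add_zero] at h1
    rw [eq_bot_iff]
    intro x hx
    obtain ⟨y, rfl⟩ := Submodule.mem_span_singleton.1 (hN.le hx)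
    have := hff _ hx
    rw [smul_eq_mul, mul_assoc, hN0 f hf, mul_zero] at this
    rw [smul_eq_mul, ← this]; exact Submodule.zero_mem _

/-- The map `x ↦ x • u` embeds the left ideal of `e` with image the span of `u`. Conversely, any
copy of the ideal is generated by the image `v` of `e`, and `e • v = c • v` together with `hV`
forces `v` onto the line of `u`. -/
theorem isotypicComponent_span_eq [IsSemisimpleRing A] {e : A} {c : ℂ} (hc : c ≠ 0)
    (h : ∀ x, ∃ t : ℂ, e * x * e = t • e) {u : V} (hu : u ≠ 0) (heu : e • u = c • u)
    (hV : ∀ v : V, ∃ t : ℂ, e • v = t • u) :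
    isotypicComponent A V (Submodule.span A {e}) = Submodule.span A {u} ∧
      IsSimpleModule A (Submodule.span A {u}) := by
  have he : e ≠ 0 := by
    rintro rfl
    rw [zero_smul, eq_comm, smul_eq_zero] at heu
    tauto
  have hee : e * e = c • e := by
    obtain ⟨t, ht⟩ := h 1
    rw [mul_one] at ht
    have h1 : (e * e) • u = (c * c) • u := by
      rw [mul_smul, heu, smul_comm, heu, smul_smul]
    rw [ht, smul_assoc, heu, smul_smul] at h1
    have := smul_left_injective ℂ hu h1
    rw [ht, mul_right_cancel₀ hc this]
  have := isSimpleModule_span_of_mul_mul he h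
  let φ : Submodule.span A {e} →ₗ[A] V := (LinearMap.toSpanSingleton A V u).domRestrict _
  have hφ : φ ⟨e, Submodule.mem_span_singleton_self e⟩ = c • u := heu
  have hinj : Function.Injective φ := by
    refine (LinearMap.injective_or_eq_zero φ).resolve_right fun h0 => ?_
    rw [h0, LinearMap.zero_apply, eq_comm, smul_eq_zero] at hφ
    tauto
  have hrange : LinearMap.range φ = Submodule.span A {u} := by
    apply le_antisymm
    · rintro _ ⟨x, rfl⟩
      exact Submodule.smul_mem _ _ (Submodule.mem_span_singleton_self u)
    · rw [Submodule.span_singleton_le_iff_mem]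
      refine ⟨c⁻¹ • ⟨e, Submodule.mem_span_singleton_self e⟩, ?_⟩
      rw [φ.map_smul_of_tower, hφ, smul_smul, inv_mul_cancel₀ hc, one_smul]
  let E : Submodule.span A {e} ≃ₗ[A] Submodule.span A {u} :=
    (LinearEquiv.ofInjective φ hinj).trans (LinearEquiv.ofEq _ _ hrange)
  refine ⟨le_antisymm (sSup_le ?_) (le_sSup ⟨E.symm⟩), IsSimpleModule.congr E.symm⟩
  rintro m ⟨ψ⟩
  intro x hx
  obtain ⟨y, hy⟩ := ψ.symm.surjective ⟨x, hx⟩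
  obtain ⟨z, hz⟩ := Submodule.mem_span_singleton.1 y.2
  set v := ψ.symm ⟨e, Submodule.mem_span_singleton_self e⟩ with hv
  have hev : e • v = c • v := by
    have h1 : e • (⟨e, Submodule.mem_span_singleton_self e⟩ : Submodule.span A {e}) =
        c • ⟨e, Submodule.mem_span_singleton_self e⟩ := Subtype.ext hee
    rw [hv, ← map_smul, h1]
    exact ψ.symm.toLinearMap.map_smul_of_tower c _
  obtain ⟨t, ht⟩ := hV v
  have hvu : (v : V) = (c⁻¹ * t) • u := by
    rw [mul_smul, ← ht, ← Submodule.coe_smul, hev, Submodule.coe_smul_of_tower, smul_smul,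
      inv_mul_cancel₀ hc, one_smul]
  have hx' : x = z • (v : V) := by
    have : y = z • ⟨e, Submodule.mem_span_singleton_self e⟩ := Subtype.ext hz.symm
    rw [this, map_smul] at hy
    exact (congrArg Subtype.val hy).symm
  rw [hx', hvu]
  exact Submodule.smul_mem _ _ (Submodule.smul_of_tower_mem _ _ (Submodule.mem_span_singleton_self u))

end Algebra

/-! ### Conjugacy of fixed-point-free involutions relative to a set -/

section Involution

theorem even_card_of_closed {α : Type*} {m : α → α} (hm : Function.Involutive m) (hm1 : ∀ x, m x ≠ x)
    {P : Finset α}     (hP : ∀ x ∈ P, m x ∈ P) : Even P.card := by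
  rw [← ZMod.natCast_eq_zero_iff_even, Finset.card_eq_sum_ones, Nat.cast_sum]
  exact Finset.sum_involution (fun x _ => m x) (fun _ _ => by decide) (fun x _ _ => hm1 x)
    (fun x hx => hP x hx) (fun x _ => hm x)

variable {α : Type*} [LinearOrder α]

/-- A choice of one of the two points of each orbit of the involution `m`, taken in `S` when
the orbit meets `S` in a single point. -/
def IsHead (S : Finset α) (m : α → α) (x : α) : Prop :=
  (x ∈ S ∧ m x ∉ S) ∨ ((x ∈ S ↔ m x ∈ S) ∧ x < m x)

instance (S : Finset α) (m : α → α) : DecidablePred (IsHead S m) :=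
  fun _ => inferInstanceAs (Decidable (_ ∨ _))

variable {S : Finset α} {m m' : α → α}

theorem isHead_apply (hm : Function.Involutive m) (hm1 : ∀ x, m x ≠ x) (x : α) :
    IsHead S m (m x) ↔ ¬ IsHead S m x := by
  have := hm1 x
  have h3 := lt_trichotomy x (m x)
  have h4 := lt_asymm (a := x) (b := m x)
  unfold IsHead
  rw [hm x]
  grind

variable [Fintype α]

theorem two_mul_card_isHead (hm : Function.Involutive m) (hm1 : ∀ x, m x ≠ x) (p : α → Prop)
    [DecidablePred p] :
    2 * (Finset.univ.filter fun x => IsHead S m x ∧ p x ∧ p (m x)).card =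
      (Finset.univ.filter fun x => p x ∧ p (m x)).card := by
  rw [← Finset.card_filter_add_card_filter_not (s := Finset.univ.filter fun x => p x ∧ p (m x))
    (IsHead S m), two_mul]
  congr 1
  · congr 1; ext x; simp; tauto
  · refine Finset.card_bij' (fun x _ => m x) (fun x _ => m x) ?_ ?_ ?_ ?_
    · intro x; simp [isHead_apply hm hm1, hm x]; tauto
    · intro x; simp [isHead_apply hm hm1, hm x]; tauto
    · intro x _; exact hm x
    · intro x _; exact hm x

/-- Orbits lie inside `S`, lie outside `S`, or cross. All three counts are determined by the size of
`S` and the number of points of `S` with partner in `S`. -/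
theorem card_isHead_fiber (hm : Function.Involutive m) (hm1 : ∀ x, m x ≠ x)
    (hm' : Function.Involutive m') (hm1' : ∀ x, m' x ≠ x)
    (h : (S.filter fun x => m x ∈ S).card = (S.filter fun x => m' x ∈ S).card) (b : Bool × Bool) :
    (Finset.univ.filter fun x => IsHead S m x ∧ (decide (x ∈ S), decide (m x ∈ S)) = b).card =
    (Finset.univ.filter fun x => IsHead S m' x ∧ (decide (x ∈ S), decide (m' x ∈ S)) = b).card := by
  have e1 : ∀ m : α → α, (Finset.univ.filter fun x => x ∈ S ∧ m x ∈ S) = S.filter fun x => m x ∈ S :=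
    fun m => by ext; simp
  have c1 := two_mul_card_isHead (S := S) hm hm1 (· ∈ S)
  have c1' := two_mul_card_isHead (S := S) hm' hm1' (· ∈ S)
  rw [e1] at c1 c1'
  have c2 := two_mul_card_isHead (S := S) hm hm1 (· ∉ S)
  have c2' := two_mul_card_isHead (S := S) hm' hm1' (· ∉ S)
  have d1 := S.card_filter_add_card_filter_not (fun x => m x ∈ S)
  have d1' := S.card_filter_add_card_filter_not (fun x => m' x ∈ S)
  have d2 := Sᶜ.card_filter_add_card_filter_not (fun x => m x ∈ S)
  have d2' := Sᶜ.card_filter_add_card_filter_not (fun x => m' x ∈ S)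
  have e2 : ∀ m : α → α, (Finset.univ.filter fun x => x ∉ S ∧ m x ∉ S) = Sᶜ.filter fun x => m x ∉ S :=
    fun m => by ext; simp
  rw [e2] at c2 c2'
  have swap : ∀ m : α → α, Function.Involutive m →
      (Sᶜ.filter fun x => m x ∈ S).card = (S.filter fun x => m x ∉ S).card := by
    intro m hm
    refine Finset.card_bij' (fun x _ => m x) (fun x _ => m x) ?_ ?_ ?_ ?_
    · intro x; simp [hm x]; tauto
    · intro x; simp [hm x]; tauto
    · intro x _; exact hm x
    · intro x _; exact hm x
  have s := swap m hm
  have s' := swap m' hm'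
  have e3 : ∀ m : α → α, (Finset.univ.filter fun x => IsHead S m x ∧ x ∈ S ∧ m x ∉ S) =
      S.filter fun x => m x ∉ S := fun m => by
    ext; simp only [Finset.mem_filter, Finset.mem_univ, true_and]; unfold IsHead; tauto
  -- The head of a crossing orbit is its point in `S`, so this type never occurs.
  have e4 : ∀ m : α → α, (Finset.univ.filter fun x => IsHead S m x ∧ x ∉ S ∧ m x ∈ S) = ∅ :=
    fun m => Finset.filter_eq_empty_iff.2 fun x _ => by unfold IsHead; tauto
  rcases b with ⟨_ | _, _ | _⟩ <;>
    simp only [Prod.mk.injEq, decide_eq_true_eq, decide_eq_false_iff_not]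
  · omega
  · rw [e4, e4]
  · rw [e3, e3]; omega
  · omega

/-- Biject the heads type by type, then extend to the other points by requiring equivariance. -/
theorem exists_perm_conj (hm : Function.Involutive m) (hm1 : ∀ x, m x ≠ x)
    (hm' : Function.Involutive m') (hm1' : ∀ x, m' x ≠ x)
    (h : (S.filter fun x => m x ∈ S).card = (S.filter fun x => m' x ∈ S).card) :
    ∃ σ : Equiv.Perm α, (∀ x, σ x ∈ S ↔ x ∈ S) ∧ ∀ x, σ (m x) = m' (σ x) := by
  have hc := card_isHead_fiber hm hm1 hm' hm1' h
  have fib : ∀ b : Bool × Bool,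
      Nonempty ({x : {x // IsHead S m x} // (decide (x.1 ∈ S), decide (m x.1 ∈ S)) = b} ≃
        {x : {x // IsHead S m' x} // (decide (x.1 ∈ S), decide (m' x.1 ∈ S)) = b}) := by
    intro b
    refine ⟨(Equiv.subtypeSubtypeEquivSubtypeInter (IsHead S m)
      (fun x => (decide (x ∈ S), decide (m x ∈ S)) = b)).trans (Equiv.trans ?_
      (Equiv.subtypeSubtypeEquivSubtypeInter (IsHead S m')
      (fun x => (decide (x ∈ S), decide (m' x ∈ S)) = b)).symm)⟩
    apply Fintype.equivOfCardEq
    rw [Fintype.card_subtype, Fintype.card_subtype]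
    exact hc b
  let F := fun b => (fib b).some
  let e := Equiv.ofFiberEquiv F
  have he : ∀ x, (((e x).1 ∈ S) ↔ x.1 ∈ S) ∧ (m' (e x).1 ∈ S ↔ m x.1 ∈ S) := by
    intro x
    have := Equiv.ofFiberEquiv_map F x
    rwa [Prod.mk.injEq, decide_eq_decide, decide_eq_decide] at this
  have hn : ∀ {x}, ¬ IsHead S m x → IsHead S m (m x) := fun h => (isHead_apply hm hm1 _).2 h
  let f : α → α := fun x => if h : IsHead S m x then e ⟨x, h⟩ else m' (e ⟨m x, hn h⟩)
  have f1 : ∀ x (h : IsHead S m x), f x = e ⟨x, h⟩ := fun x h => dif_pos h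
  have f2 : ∀ x (h : ¬ IsHead S m x), f x = m' (e ⟨m x, hn h⟩) := fun x h => dif_neg h
  have hf : ∀ x, IsHead S m' (f x) ↔ IsHead S m x := by
    intro x
    by_cases h : IsHead S m x
    · rw [f1 x h]; simp [h, (e ⟨x, h⟩).2]
    · rw [f2 x h, isHead_apply hm' hm1']; simp [h, (e _).2]
  have hinj : Function.Injective f := by
    intro x y hxy
    have hiff := (hf x).symm.trans ((iff_of_eq (congrArg _ hxy)).trans (hf y))
    by_cases h : IsHead S m x
    · rw [f1 x h, f1 y (hiff.1 h)] at hxy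
      exact congrArg Subtype.val (e.injective (Subtype.ext hxy))
    · rw [f2 x h, f2 y (fun h' => h (hiff.2 h'))] at hxy
      exact hm.injective (congrArg Subtype.val (e.injective (Subtype.ext (hm'.injective hxy))))
  refine ⟨Equiv.ofBijective f (Finite.injective_iff_bijective.1 hinj), fun x => ?_, fun x => ?_⟩
  · change f x ∈ S ↔ _
    by_cases h : IsHead S m x
    · rw [f1 x h]; exact (he _).1
    · rw [f2 x h, (he _).2]; simp [hm x]
  · change f (m x) = m' (f x)
    by_cases h : IsHead S m x
    · have h' : ¬ IsHead S m (m x) := by rw [isHead_apply hm hm1]; simpa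
      rw [f1 x h, f2 _ h']
      simp only [hm x]
    · rw [f1 _ (hn h), f2 _ h, hm']

end Involution

section Matchings

variable {k : ℕ}

/-! ### The partner involution of a perfect matching -/

namespace PerfMatching

/-- The vertex joined to `x` by the matching `M`. -/
noncomputable def partner (M : PerfMatching k) (x : Fin (2 * k)) : Fin (2 * k) :=
  (M.2.1 (M.2.2 x)).choose

theorem adj_partner (M : PerfMatching k) (x : Fin (2 * k)) : M.1.Adj x (M.partner x) :=
  (M.2.1 (M.2.2 x)).choose_spec.1

theorem adj_iff (M : PerfMatching k) {x y : Fin (2 * k)} : M.1.Adj x y ↔ M.partner x = y :=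
  ⟨fun h => ((M.2.1 (M.2.2 x)).choose_spec.2 y h).symm, fun h => h ▸ M.adj_partner x⟩

theorem partner_involutive (M : PerfMatching k) : Function.Involutive M.partner :=
  fun x => M.adj_iff.1 (M.adj_partner x).symm

theorem partner_ne (M : PerfMatching k) (x : Fin (2 * k)) : M.partner x ≠ x :=
  (M.1.adj_sub (M.adj_partner x)).ne'

theorem ext_partner {M M' : PerfMatching k} (h : ∀ x, M.partner x = M'.partner x) : M = M' := by
  refine Subtype.ext (SimpleGraph.Subgraph.ext ?_ ?_)
  · rw [Set.eq_univ_of_forall M.2.2, Set.eq_univ_of_forall M'.2.2]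
  · ext x y
    rw [M.adj_iff, M'.adj_iff, h]

theorem partner_smul (σ : Equiv.Perm (Fin (2 * k))) (M : PerfMatching k) (x : Fin (2 * k)) :
    (σ • M).partner x = σ (M.partner (σ⁻¹ x)) :=
  (σ • M).adj_iff.1 ⟨σ⁻¹ x, M.partner (σ⁻¹ x), M.adj_partner _, σ.apply_symm_apply x, rfl⟩

/-- The perfect matching with a given partner involution. -/
def ofInvolutive (m : Fin (2 * k) → Fin (2 * k)) (hm : Function.Involutive m)
    (hm1 : ∀ x, m x ≠ x) : PerfMatching k :=
  ⟨{ verts := Set.univ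
     Adj := fun x y => m x = y
     adj_sub := by rintro x _ rfl; exact (hm1 x).symm
     edge_vert := fun _ => Set.mem_univ _
     symm := ⟨by rintro x _ rfl; exact hm x⟩ },
    fun x _ => ⟨m x, rfl, fun _ h => Eq.symm h⟩, fun _ => Set.mem_univ _⟩

theorem partner_ofInvolutive (m : Fin (2 * k) → Fin (2 * k)) (hm : Function.Involutive m)
    (hm1 : ∀ x, m x ≠ x) (x : Fin (2 * k)) : (ofInvolutive m hm hm1).partner x = m x :=
  (adj_iff _).1 rfl

/-- `P` is a union of edges of `M`. -/
def Closed (M : PerfMatching k) (P : Finset (Fin (2 * k))) : Prop := ∀ x ∈ P, M.partner x ∈ P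

noncomputable instance (M : PerfMatching k) : DecidablePred M.Closed := Classical.decPred _

theorem Closed.even_card {M : PerfMatching k} {P : Finset (Fin (2 * k))} (h : M.Closed P) :
    Even P.card :=
  even_card_of_closed M.partner_involutive M.partner_ne h

theorem Closed.inter {M : PerfMatching k} {P Q : Finset (Fin (2 * k))} (h : M.Closed P)
    (h' : M.Closed Q) : M.Closed (P ∩ Q) := fun x hx =>
  Finset.mem_inter.2 ⟨h x (Finset.mem_inter.1 hx).1, h' x (Finset.mem_inter.1 hx).2⟩

theorem closed_empty (M : PerfMatching k) : M.Closed ∅ := fun _ h => absurd h (Finset.notMem_empty _)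

theorem closed_pair (M : PerfMatching k) {x y : Fin (2 * k)} (h : x ≠ y) :
    M.Closed {x, y} ↔ M.partner x = y := by
  constructor
  · intro hc
    have := hc x (by simp)
    have := M.partner_ne x
    grind
  · rintro rfl z hz
    rw [Finset.mem_insert, Finset.mem_singleton] at hz
    rcases hz with rfl | rfl
    · simp
    · simp [M.partner_involutive x]

theorem closed_smul (M : PerfMatching k) (σ : Equiv.Perm (Fin (2 * k)))
    (P : Finset (Fin (2 * k))) :
    (σ • M).Closed (P.map σ.toEmbedding) ↔ M.Closed P := by
  simp only [Closed, partner_smul, Finset.mem_map_equiv, Equiv.Perm.inv_def, Equiv.symm_apply_apply]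
  exact ⟨fun h x hx => by simpa using h (σ x) (by simpa), fun h x => h _⟩

/-- The number of vertices in `S` whose partner is in `S`. -/
noncomputable def inner (S : Finset (Fin (2 * k))) (M : PerfMatching k) : ℕ :=
  (S.filter fun x => M.partner x ∈ S).card

theorem inner_le (S : Finset (Fin (2 * k))) (M : PerfMatching k) : M.inner S ≤ S.card :=
  Finset.card_filter_le _ _

theorem even_inner (S : Finset (Fin (2 * k))) (M : PerfMatching k) : Even (M.inner S) :=
  even_card_of_closed M.partner_involutive M.partner_ne fun x hx => by
    rw [Finset.mem_filter] at hx ⊢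
    exact ⟨hx.2, by rw [M.partner_involutive]; exact hx.1⟩

theorem inner_eq_card_iff (S : Finset (Fin (2 * k))) (M : PerfMatching k) :
    M.inner S = S.card ↔ M.Closed S :=
  Finset.card_filter_eq_iff

theorem exists_smul_eq {S : Finset (Fin (2 * k))} {M M' : PerfMatching k}
    (h : M.inner S = M'.inner S) :
    ∃ σ : Equiv.Perm (Fin (2 * k)), (∀ x, σ x ∈ S ↔ x ∈ S) ∧ σ • M = M' := by
  obtain ⟨σ, h1, h2⟩ := exists_perm_conj M.partner_involutive M.partner_ne
    M'.partner_involutive M'.partner_ne h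
  refine ⟨σ, h1, ext_partner fun x => ?_⟩
  rw [partner_smul, h2]
  exact congrArg _ (σ.apply_symm_apply x)

/-- The matching of each 2i with 2i+1 has every even initial segment closed; a permutation carries
the segment of the right size to `P`. -/
theorem exists_closed {P : Finset (Fin (2 * k))} (hP : Even P.card) :
    ∃ M : PerfMatching k, M.Closed P := by
  let m : Fin (2 * k) → Fin (2 * k) := fun x =>
    if h : x.1 % 2 = 0 then ⟨x.1 + 1, by have := x.2; omega⟩ else
      ⟨x.1 - 1, by have := x.2; omega⟩
  have hm : ∀ x, (m x).1 = if x.1 % 2 = 0 then x.1 + 1 else x.1 - 1 := by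
    intro x; simp only [m]; split_ifs <;> rfl
  have hc : P.card ≤ 2 * k := by simpa using P.card_le_univ
  let Q : Finset (Fin (2 * k)) := Finset.univ.filter fun x => x.1 < P.card
  have hQ : Q.card = P.card := by
    have : Q = Finset.univ.map (Fin.castLEEmb hc) := by
      ext x
      simp only [Q, Finset.mem_filter, Finset.mem_univ, true_and, Finset.mem_map]
      exact ⟨fun h => ⟨⟨x, h⟩, rfl⟩, by rintro ⟨y, rfl⟩; exact y.2⟩
    simp [this]
  let M := ofInvolutive m (fun x => Fin.ext (by rw [hm, hm]; split_ifs <;> omega))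
    (fun x h => by have := congrArg Fin.val h; rw [hm] at this; split_ifs at this <;> omega)
  have hM : M.Closed Q := by
    intro x hx
    have hx' : M.partner x = m x := partner_ofInvolutive _ _ _ _
    rw [hx']
    simp only [Q, Finset.mem_filter, Finset.mem_univ, true_and] at hx ⊢
    obtain ⟨c, hc⟩ := hP
    rw [hm]; split_ifs <;> omega
  let e : {x // x ∈ Q} ≃ {x // x ∈ P} := Finset.equivOfCardEq hQ
  refine ⟨e.extendSubtype • M, ?_⟩
  have : P = Q.map e.extendSubtype.toEmbedding := by
    refine (Finset.eq_of_subset_of_card_le ?_ ?_).symm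
    · intro x hx
      obtain ⟨y, hy, rfl⟩ := Finset.mem_map.1 hx
      exact e.extendSubtype_mem y hy
    · rw [Finset.card_map, hQ]
  have h := (closed_smul M e.extendSubtype Q).2 hM
  rwa [← this] at h

end PerfMatching

open PerfMatching

theorem coversByTwo_iff {M : PerfMatching k} {S : Finset (Fin (2 * k))} (hS : S.card = 4) :
    CoversByTwo M S ↔ M.Closed S := by
  constructor
  · rintro ⟨a, b, c, d, rfl, hab, hcd⟩ x hx
    have hba := M.adj_iff.1 hab.symm
    have hdc := M.adj_iff.1 hcd.symm
    rw [M.adj_iff] at hab hcd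
    simp only [Finset.mem_insert, Finset.mem_singleton] at hx ⊢
    rcases hx with rfl | rfl | rfl | rfl <;> tauto
  · intro h
    obtain ⟨a, ha⟩ := Finset.card_pos.1 (by omega : 0 < S.card)
    obtain ⟨c, hc, hc'⟩ := Finset.exists_mem_notMem_of_card_lt_card
      (s := {a, M.partner a}) (t := S)
      (by have := Finset.card_le_two (a := a) (b := M.partner a); omega)
    simp only [Finset.mem_insert, Finset.mem_singleton, not_or] at hc'
    refine ⟨a, _, c, _, ?_, M.adj_partner a, M.adj_partner c⟩
    symm
    apply Finset.eq_of_subset_of_card_le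
    · intro x hx
      simp only [Finset.mem_insert, Finset.mem_singleton] at hx
      rcases hx with rfl | rfl | rfl | rfl
      exacts [ha, h _ ha, hc, h _ hc]
    · rw [hS, Finset.card_insert_of_notMem, Finset.card_insert_of_notMem, Finset.card_pair]
      · exact (M.partner_ne c).symm
      · have := M.partner_involutive.injective.ne hc'.1
        simp [Ne.symm hc'.2, this.symm]
      · have h1 := M.partner_involutive a
        have := (M.partner_ne a).symm
        have h2 : a ≠ M.partner c := by
          intro h2; apply hc'.2; rw [h2, M.partner_involutive]
        simp [h2, this, Ne.symm hc'.1]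

/-! ### Vectors of the matching space -/

theorem smul_apply_matching (σ : Equiv.Perm (Fin (2 * k))) (r : ℂ) (v : MatchingSpace k)
    (M : PerfMatching k) :
    (matchingRep k).asModuleEquiv ((MonoidAlgebra.single σ r : GroupAlg (2 * k)) • v) M =
      r * (matchingRep k).asModuleEquiv v (σ⁻¹ • M) := by
  rw [Representation.asModuleEquiv_map_smul, Representation.asAlgebraHom_single]
  rfl

theorem matchingSpace_ext {v v' : MatchingSpace k}
    (h : ∀ M, (matchingRep k).asModuleEquiv v M = (matchingRep k).asModuleEquiv v' M) : v = v' :=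
  (matchingRep k).asModuleEquiv.injective (funext h)

/-- The characteristic vector of the set of matchings of which `P` is a union of edges. -/
noncomputable def closedVec (P : Finset (Fin (2 * k))) : MatchingSpace k :=
  (matchingRep k).asModuleEquiv.symm fun M => if M.Closed P then 1 else 0

theorem closedVec_apply (P : Finset (Fin (2 * k))) (M : PerfMatching k) :
    (matchingRep k).asModuleEquiv (closedVec P) M = if M.Closed P then 1 else 0 := by
  rw [closedVec, LinearEquiv.apply_symm_apply]

theorem w_eq_closedVec {S : Finset (Fin (2 * k))} (hS : S.card = 4) : w S = closedVec S := by
  apply matchingSpace_ext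
  intro M
  classical
  rw [closedVec_apply, w, LinearEquiv.apply_symm_apply, Set.indicator_apply]
  exact if_congr (coversByTwo_iff hS) rfl rfl

theorem single_smul_closedVec (σ : Equiv.Perm (Fin (2 * k))) (P : Finset (Fin (2 * k))) :
    (MonoidAlgebra.single σ (1 : ℂ) : GroupAlg (2 * k)) • closedVec P =
      closedVec (P.map σ.toEmbedding) := by
  apply matchingSpace_ext
  intro M
  rw [smul_apply_matching, closedVec_apply, closedVec_apply, one_mul]
  refine if_congr ?_ rfl rfl
  rw [← closed_smul (σ⁻¹ • M) σ, smul_inv_smul]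

/-- The span of the characteristic vectors of the sets satisfying `p`. -/
noncomputable def closedSpan (k : ℕ) (p : ℕ → Prop) :
    Submodule (GroupAlg (2 * k)) (MatchingSpace k) where
  __ := Submodule.span ℂ {v : MatchingSpace k | ∃ P : Finset (Fin (2 * k)), p P.card ∧ v = closedVec P}
  smul_mem' := by
    intro a v hv
    induction a using MonoidAlgebra.induction_linear with
    | zero => rw [zero_smul]; exact Submodule.zero_mem _
    | add a b ha hb => rw [add_smul]; exact Submodule.add_mem _ ha hb
    | single σ r =>
      have : (MonoidAlgebra.single σ r : GroupAlg (2 * k)) = r • MonoidAlgebra.single σ 1 := by simp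
      rw [this, smul_assoc]
      refine Submodule.smul_mem _ r ?_
      induction hv using Submodule.span_induction with
      | mem v hv =>
        obtain ⟨P, hP, rfl⟩ := hv
        rw [single_smul_closedVec]
        exact Submodule.subset_span ⟨_, by rwa [Finset.card_map], rfl⟩
      | zero => rw [smul_zero]; exact Submodule.zero_mem _
      | add x y _ _ hx hy => rw [smul_add]; exact Submodule.add_mem _ hx hy
      | smul c x _ hx => rw [smul_comm]; exact Submodule.smul_mem _ c hx

theorem closedSpan_restrictScalars (p : ℕ → Prop) : (closedSpan k p).restrictScalars ℂ =
    Submodule.span ℂ {v : MatchingSpace k | ∃ P : Finset (Fin (2 * k)), p P.card ∧ v = closedVec P} :=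
  rfl

theorem closedVec_mem_closedSpan {p : ℕ → Prop} {P : Finset (Fin (2 * k))} (h : p P.card) :
    closedVec P ∈ closedSpan k p :=
  Submodule.subset_span (s := {_v : MatchingSpace k | _}) ⟨P, h, rfl⟩

theorem closedSpan_mono {p q : ℕ → Prop} (h : ∀ i, p i → q i) : closedSpan k p ≤ closedSpan k q :=
  Submodule.span_mono (R := ℂ) (s := {_v : MatchingSpace k | _}) (t := {_v : MatchingSpace k | _})
    fun _ ⟨P, hP, hv⟩ => ⟨P, h _ hP, hv⟩

theorem closedSpan_le {p : ℕ → Prop} {N : Submodule (GroupAlg (2 * k)) (MatchingSpace k)}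
    (h : ∀ P : Finset (Fin (2 * k)), p P.card → closedVec P ∈ N) : closedSpan k p ≤ N :=
  Submodule.span_le (R := ℂ) (s := {_v : MatchingSpace k | _}) (p := N.restrictScalars ℂ) |>.2
    (by rintro _ ⟨P, hP, rfl⟩; exact h P hP)

/-- Supplies a combination of two-point vectors that is linear in `inner S`; each edge inside `S` is
counted from both ends. -/
theorem sum_sum_pair_apply (S : Finset (Fin (2 * k))) (M : PerfMatching k) :
    (matchingRep k).asModuleEquiv
      (∑ x ∈ S, ∑ y ∈ S, if x = y then 0 else closedVec {x, y}) M = M.inner S := by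
  have : ∀ x y : Fin (2 * k), (matchingRep k).asModuleEquiv
      (if x = y then 0 else closedVec {x, y}) M = if M.partner x = y then 1 else 0 := by
    intro x y
    split_ifs with h1 h2 h2
    · exact absurd (h2.trans h1.symm) (M.partner_ne x)
    · rw [map_zero]; rfl
    · rw [closedVec_apply, if_pos ((M.closed_pair h1).2 h2)]
    · rw [closedVec_apply, if_neg fun h => h2 ((M.closed_pair h1).1 h)]
  rw [map_sum, Finset.sum_apply]
  simp_rw [map_sum, Finset.sum_apply, this]
  simp [PerfMatching.inner]

/-- A vector that is invariant under the setwise stabilizer of `S` is a multiple of `closedVec S`,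
up to characteristic vectors of smaller sets. -/
theorem exists_sub_smul_mem_closedSpan {S : Finset (Fin (2 * k))}
    (hS : S.card = 0 ∨ S.card = 2 ∨ S.card = 4) {v : MatchingSpace k}
    (hv : ∀ σ : Equiv.Perm (Fin (2 * k)), (∀ x, σ x ∈ S ↔ x ∈ S) →
      (MonoidAlgebra.single σ (1 : ℂ) : GroupAlg (2 * k)) • v = v) :
    ∃ z : ℂ, v - z • closedVec S ∈ closedSpan k fun i => i < S.card ∧ Even i := by
  -- The stabilizer of `S` is transitive on matchings with equal `inner S`, so `v` is a function `F`
  -- of that number.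
  have hfac : Function.FactorsThrough ((matchingRep k).asModuleEquiv v) (PerfMatching.inner S) := by
    intro M M' h
    obtain ⟨σ, h1, rfl⟩ := exists_smul_eq h
    conv_rhs => rw [← hv σ h1]
    rw [smul_apply_matching, inv_smul_smul, one_mul]
  obtain ⟨F, hF⟩ := (Function.factorsThrough_iff _).1 hfac
  have hF : ∀ M, (matchingRep k).asModuleEquiv v M = F (M.inner S) := fun M => congrFun hF M
  have hclosed : ∀ M : PerfMatching k, (matchingRep k).asModuleEquiv (closedVec S) M =
      if M.inner S = S.card then 1 else 0 := by
    intro M; rw [closedVec_apply]; exact if_congr (M.inner_eq_card_iff S).symm rfl rfl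
  have hempty : ∀ M : PerfMatching k, (matchingRep k).asModuleEquiv (closedVec ∅) M = 1 := by
    intro M; rw [closedVec_apply, if_pos M.closed_empty]
  have hone : ∀ c : ℂ, S.card ≠ 0 → c • closedVec ∅ ∈ closedSpan k fun i => i < S.card ∧ Even i :=
    fun c h => Submodule.smul_of_tower_mem _ c
      (closedVec_mem_closedSpan (by rw [Finset.card_empty]; exact ⟨Nat.pos_of_ne_zero h, by simp⟩))
  rcases hS with hS | hS | hS
  · refine ⟨F 0, ?_⟩
    convert Submodule.zero_mem _
    rw [sub_eq_zero]
    apply matchingSpace_ext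
    intro M
    have := M.inner_le S
    have h0 : M.inner S = 0 := by omega
    simp [hF, hclosed, hS, h0]
  · refine ⟨F 2 - F 0, ?_⟩
    convert hone (F 0) (by omega) using 1
    apply matchingSpace_ext
    intro M
    have := M.inner_le S
    obtain ⟨c, hc⟩ := M.even_inner S
    have h0 : M.inner S = 0 ∨ M.inner S = 2 := by omega
    rcases h0 with h0 | h0 <;> simp [hF, hclosed, hS, h0, hempty]
  -- Interpolate `F` linearly through 0 and 2; the error at 4 is this second difference.
  · refine ⟨F 4 - 2 * F 2 + F 0, ?_⟩
    have hD : ((F 2 - F 0) / 2) • (∑ x ∈ S, ∑ y ∈ S, if x = y then 0 else closedVec {x, y}) ∈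
        closedSpan k fun i => i < S.card ∧ Even i := by
      refine Submodule.smul_of_tower_mem _ _
        (Submodule.sum_mem _ fun x _ => Submodule.sum_mem _ fun y _ => ?_)
      split_ifs with h
      · exact Submodule.zero_mem _
      · exact closedVec_mem_closedSpan (by rw [Finset.card_pair h, hS]; decide)
    convert Submodule.add_mem _ (hone (F 0) (by omega)) hD using 1
    apply matchingSpace_ext
    intro M
    have := M.inner_le S
    obtain ⟨c, hc⟩ := M.even_inner S
    have h0 : M.inner S = 0 ∨ M.inner S = 2 ∨ M.inner S = 4 := by omega
    rw [map_add, map_smul _ ((F 2 - F 0) / 2), Pi.add_apply, Pi.smul_apply, sum_sum_pair_apply]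
    rcases h0 with h0 | h0 | h0 <;> simp [hF, hclosed, hS, h0, hempty]; ring

end Matchings

open PerfMatching

/-! ### Signed sums over the stabilizer of a colouring -/

section StabSum

variable {n : ℕ}

/-- The sum of the permutations preserving the fibers of `f`, weighted by the character `χ`. -/
noncomputable def stabSum (f : Fin n → ℕ) (χ : Equiv.Perm (Fin n) →* ℂ) : GroupAlg n :=
  ∑ σ : Equiv.Perm (Fin n) with ∀ x, f (σ x) = f x, MonoidAlgebra.single σ (χ σ)

/-- The sign character with complex values. -/
noncomputable def signChar (n : ℕ) : Equiv.Perm (Fin n) →* ℂ :=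
  (Int.castRingHom ℂ).toMonoidHom.comp ((Units.coeHom ℤ).comp Equiv.Perm.sign)

theorem signChar_apply (σ : Equiv.Perm (Fin n)) :
    signChar n σ = ((Equiv.Perm.sign σ : ℤ) : ℂ) := rfl

theorem signChar_eq_or (σ : Equiv.Perm (Fin n)) : signChar n σ = 1 ∨ signChar n σ = -1 := by
  rw [signChar_apply]
  rcases Int.units_eq_one_or (Equiv.Perm.sign σ) with h | h <;> simp [h]

variable {f : Fin n → ℕ} {χ : Equiv.Perm (Fin n) →* ℂ}

theorem stabSum_mul_single {h : Equiv.Perm (Fin n)} (hh : ∀ x, f (h x) = f x) :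
    stabSum f χ * MonoidAlgebra.single h (χ h) = stabSum f χ := by
  rw [stabSum, Finset.sum_mul]
  refine Finset.sum_equiv (Equiv.mulRight h) ?_ ?_
  · intro σ
    simp only [Finset.mem_filter, Finset.mem_univ, true_and, Equiv.coe_mulRight,
      Equiv.Perm.mul_apply]
    exact ⟨fun H x => (H _).trans (hh x), fun H x => by
      have := H (h.symm x); rwa [h.apply_symm_apply, ← hh (h.symm x), h.apply_symm_apply] at this⟩
  · intro σ _
    rw [MonoidAlgebra.single_mul_single, Equiv.coe_mulRight, map_mul]

theorem single_mul_stabSum {h : Equiv.Perm (Fin n)} (hh : ∀ x, f (h x) = f x) :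
    MonoidAlgebra.single h (χ h) * stabSum f χ = stabSum f χ := by
  rw [stabSum, Finset.mul_sum]
  refine Finset.sum_equiv (Equiv.mulLeft h) ?_ ?_
  · intro σ
    simp [hh]
  · intro σ _
    rw [MonoidAlgebra.single_mul_single, Equiv.coe_mulLeft, map_mul]

theorem stabSum_mul_self (f : Fin n → ℕ) (χ : Equiv.Perm (Fin n) →* ℂ) :
    ∃ c : ℂ, c ≠ 0 ∧ stabSum f χ * stabSum f χ = c • stabSum f χ := by
  refine ⟨((Finset.univ.filter fun σ : Equiv.Perm (Fin n) => ∀ x, f (σ x) = f x).card : ℂ), ?_, ?_⟩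
  · rw [Nat.cast_ne_zero, Finset.card_ne_zero]
    exact ⟨1, by simp⟩
  · conv_lhs => enter [1]; rw [stabSum]
    rw [Finset.sum_mul, Finset.sum_congr rfl fun σ hσ =>
      single_mul_stabSum (Finset.mem_filter.1 hσ).2, Finset.sum_const, Nat.cast_smul_eq_nsmul]

theorem stabSum_comp (g : Equiv.Perm (Fin n)) (hχ : ∀ σ, χ (g * σ * g⁻¹) = χ σ) :
    stabSum (f ∘ g) χ = MonoidAlgebra.single g⁻¹ 1 * stabSum f χ * MonoidAlgebra.single g 1 := by
  rw [stabSum, stabSum, Finset.mul_sum, Finset.sum_mul]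
  refine Finset.sum_equiv (MulAut.conj g).toEquiv ?_ ?_
  · intro σ
    simp only [Finset.mem_filter, Finset.mem_univ, true_and, Function.comp_apply,
      MulEquiv.toEquiv_eq_coe, MulEquiv.coe_toEquiv, MulAut.conj_apply, Equiv.Perm.mul_apply]
    exact ⟨fun H x => by simpa using H (g⁻¹ x), fun H x => by simpa using H (g x)⟩
  · intro σ _
    simp only [MonoidAlgebra.single_mul_single, MulEquiv.toEquiv_eq_coe, MulEquiv.coe_toEquiv,
      MulAut.conj_apply, hχ, one_mul, mul_one]
    congr 1
    group

end StabSum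

/-! ### The invariant inner product -/

section Inner

variable {k : ℕ}

noncomputable instance : Fintype (PerfMatching k) :=
  have : Finite (PerfMatching k) := Finite.of_injective (fun M : PerfMatching k => M.partner)
    fun _ _ h => ext_partner (congrFun h)
  Fintype.ofFinite _

/-- The standard Hermitian form on the matching space. -/
noncomputable def herm (v v' : MatchingSpace k) : ℂ :=
  ∑ M, star ((matchingRep k).asModuleEquiv v M) * (matchingRep k).asModuleEquiv v' M

theorem herm_self_eq_zero {v : MatchingSpace k} (h : herm v v = 0) : v = 0 := by
  apply matchingSpace_ext
  intro M
  have h1 : ∑ M, ‖(matchingRep k).asModuleEquiv v M‖ ^ 2 = 0 := by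
    have : ((∑ M, ‖(matchingRep k).asModuleEquiv v M‖ ^ 2 : ℝ) : ℂ) = 0 := by
      rw [← h, herm, Complex.ofReal_sum]
      exact Finset.sum_congr rfl fun M _ => by
        rw [Complex.star_def, Complex.conj_mul', Complex.ofReal_pow]
    exact_mod_cast this
  have := (Finset.sum_eq_zero_iff_of_nonneg fun M _ => by positivity).1 h1 M (Finset.mem_univ M)
  rw [map_zero]
  simpa using this

theorem herm_zero_right (v : MatchingSpace k) : herm v 0 = 0 := by
  simp [herm]

theorem herm_smul_right (c : ℂ) (v v' : MatchingSpace k) : herm v (c • v') = c * herm v v' := by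
  simp only [herm, map_smul, Pi.smul_apply, smul_eq_mul, Finset.mul_sum]
  exact Finset.sum_congr rfl fun M _ => by ring

theorem herm_sum_right {ι : Type*} (s : Finset ι) (v : MatchingSpace k) (F : ι → MatchingSpace k) :
    herm v (∑ i ∈ s, F i) = ∑ i ∈ s, herm v (F i) := by
  simp only [herm, map_sum, Finset.sum_apply, Finset.mul_sum]
  exact Finset.sum_comm

theorem herm_sum_left {ι : Type*} (s : Finset ι) (v : MatchingSpace k) (F : ι → MatchingSpace k) :
    herm (∑ i ∈ s, F i) v = ∑ i ∈ s, herm (F i) v := by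
  simp only [herm, map_sum, Finset.sum_apply, star_sum, Finset.sum_mul]
  exact Finset.sum_comm

theorem herm_single_left (σ : Equiv.Perm (Fin (2 * k))) (r : ℂ) (v v' : MatchingSpace k) :
    herm ((MonoidAlgebra.single σ r : GroupAlg (2 * k)) • v) v' =
      herm v ((MonoidAlgebra.single σ⁻¹ (star r) : GroupAlg (2 * k)) • v') := by
  rw [herm, herm]
  refine Fintype.sum_equiv (MulAction.toPerm σ⁻¹) _ _ fun M => ?_
  rw [smul_apply_matching, smul_apply_matching, MulAction.toPerm_apply, inv_inv, smul_inv_smul,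
    star_mul']
  ring

/-- The stabilizer is closed under inversion and the character is real, so the sum is self-adjoint.
-/
theorem herm_stabSum_left (f : Fin (2 * k) → ℕ) {χ : Equiv.Perm (Fin (2 * k)) →* ℂ}
    (hχ : ∀ σ, χ σ = 1 ∨ χ σ = -1) (v v' : MatchingSpace k) :
    herm (stabSum f χ • v) v' = herm v (stabSum f χ • v') := by
  rw [stabSum, Finset.sum_smul, Finset.sum_smul, herm_sum_left, herm_sum_right]
  refine Finset.sum_equiv (Equiv.inv _) ?_ ?_
  · intro σ
    simp only [Finset.mem_filter, Finset.mem_univ, true_and, Equiv.inv_apply, Equiv.Perm.inv_def]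
    exact ⟨fun H x => by simpa using (H (σ.symm x)).symm, fun H x => by simpa using (H (σ x)).symm⟩
  · intro σ _
    rw [herm_single_left, Equiv.inv_apply]
    congr 3
    have : χ σ * χ σ⁻¹ = 1 := by rw [← map_mul, mul_inv_cancel, map_one]
    rcases hχ σ with h | h <;> rw [h] at this ⊢ <;> simp at this ⊢
    · exact this
    · rw [← this]; simp

/-- Both sums are self-adjoint and square to nonzero multiples of themselves. If `b a b v = 0`, then
`a b v` has norm zero. Pairing it with `v`, an eigenvector of `a`, gives ⟨v, b v⟩ = 0, hence `b v`
has norm zero. -/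
theorem stabSum_smul_stabSum_smul_stabSum_smul_ne_zero (f g : Fin (2 * k) → ℕ)
    {χ ψ : Equiv.Perm (Fin (2 * k)) →* ℂ} (hχ : ∀ σ, χ σ = 1 ∨ χ σ = -1)
    (hψ : ∀ σ, ψ σ = 1 ∨ ψ σ = -1) {v : MatchingSpace k} {c : ℂ} (hc : c ≠ 0)
    (hv : stabSum f χ • v = c • v) (h0 : stabSum g ψ • v ≠ 0) :
    stabSum g ψ • stabSum f χ • stabSum g ψ • v ≠ 0 := by
  obtain ⟨α, hα, hα'⟩ := stabSum_mul_self f χ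
  obtain ⟨β, hβ, hβ'⟩ := stabSum_mul_self g ψ
  set a := stabSum f χ
  set b := stabSum g ψ
  have ha : ∀ v : MatchingSpace k, a • a • v = α • a • v := fun v => by
    rw [← mul_smul, hα', smul_assoc]
  have hb : ∀ v : MatchingSpace k, b • b • v = β • b • v := fun v => by
    rw [← mul_smul, hβ', smul_assoc]
  intro h
  have h1 : a • b • v = 0 := by
    apply herm_self_eq_zero
    rw [herm_stabSum_left f hχ, ha, herm_smul_right, herm_stabSum_left g hψ, h, herm_zero_right,
      mul_zero]
  have h2 : herm v (b • v) = 0 := by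
    have h3 := herm_zero_right v
    rw [← h1, ← herm_stabSum_left f hχ, hv] at h3
    simpa [herm, ← Finset.mul_sum, mul_assoc, hc] using h3
  refine h0 (herm_self_eq_zero ?_)
  rw [herm_stabSum_left g hψ, hb, herm_smul_right, h2, mul_zero]

end Inner

/-! ### Arrangements with two rows -/

theorem eq_zero_of_eq_neg {V : Type*} [AddCommGroup V] [Module ℂ V] {v : V} (h : v = -v) :
    v = 0 := by
  have h2 : (2 : ℂ) • v = 0 := by rw [two_smul]; nth_rw 1 [h]; exact neg_add_cancel v
  exact (smul_eq_zero.1 h2).resolve_left two_ne_zero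

/-- The functions `r` and `c` giving the row and the column of each entry of a tableau with at
most two rows. -/
structure TwoRowed {n : ℕ} (r c : Fin n → ℕ) : Prop where
  le_one : ∀ x, r x ≤ 1
  ext : ∀ x y, r x = r y → c x = c y → x = y
  exists_above : ∀ y, r y = 1 → ∃ x, r x = 0 ∧ c x = c y

/-- The entries of the second row. -/
def secondRow {n : ℕ} (r : Fin n → ℕ) : Finset (Fin n) := Finset.univ.filter fun x => r x = 1

theorem mem_secondRow {n : ℕ} {r : Fin n → ℕ} {x : Fin n} : x ∈ secondRow r ↔ r x = 1 := by
  simp [secondRow]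

/-- The generator of the constituent. -/
noncomputable def polytabloid {k : ℕ} (r c : Fin (2 * k) → ℕ) : MatchingSpace k :=
  stabSum c (signChar (2 * k)) • closedVec (secondRow r)

namespace TwoRowed

/-! ### The Young symmetrizer of a two-rowed tableau in the group algebra -/

section Algebra

variable {n : ℕ} {r c : Fin n → ℕ} (H : TwoRowed r c)
include H

theorem row_eq_iff (x y : Fin n) : r x = r y ↔ (x ∈ secondRow r ↔ y ∈ secondRow r) := by
  rw [mem_secondRow, mem_secondRow]
  have := H.le_one x
  have := H.le_one y
  omega

omit H in
theorem stabSum_mul_swap {x y : Fin n} (hxy : x ≠ y) (hc : c x = c y) :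
    stabSum c (signChar n) * MonoidAlgebra.single (Equiv.swap x y) 1 = -stabSum c (signChar n) := by
  have h := stabSum_mul_single (f := c) (χ := signChar n) (h := Equiv.swap x y) (fun z => by
    rw [Equiv.swap_apply_def]; split_ifs with h1 h2
    · rw [h1, hc]
    · rw [h2, hc]
    · rfl)
  rw [signChar_apply, Equiv.Perm.sign_swap hxy] at h
  rw [← neg_eq_iff_eq_neg, ← mul_neg]
  convert h using 2
  simp

/-- Induct on the number of second-row entries `y` outside the image of the second row under `g`. If
there are none, `g` preserves rows and is absorbed by the row sum. Otherwise let `x` be above `y`.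
If `x` is in the image, swapping `x` and `y` lowers the count at the cost of a sign. If not, both
preimages lie in the first row, so the swap is absorbed on the right with sign 1 and on the left
with sign -1, and the product vanishes. -/
theorem exists_mul_single_mul (g : Equiv.Perm (Fin n)) :
    ∃ t : ℂ, stabSum c (signChar n) * MonoidAlgebra.single g 1 * stabSum r 1 =
      t • (stabSum c (signChar n) * stabSum r 1) := by
  induction hd : (secondRow r \ (secondRow r).map g.toEmbedding).card using
    Nat.strong_induction_on generalizing g with
  | _ d ih =>
  have hmem : ∀ x, x ∈ (secondRow r).map g.toEmbedding ↔ r (g⁻¹ x) = 1 := fun x => by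
    rw [Finset.mem_map_equiv, mem_secondRow]; rfl
  by_cases hsub : secondRow r ⊆ (secondRow r).map g.toEmbedding
  · have heq := Finset.eq_of_subset_of_card_le hsub (by rw [Finset.card_map])
    refine ⟨1, ?_⟩
    have : MonoidAlgebra.single g (1 : ℂ) * stabSum r 1 = stabSum r 1 :=
      single_mul_stabSum (χ := 1) fun x => by
        rw [H.row_eq_iff]
        conv_lhs => rw [heq]
        simp
    rw [mul_assoc, this, one_smul]
  · obtain ⟨y, hy, hyg⟩ := Finset.not_subset.1 hsub
    rw [mem_secondRow] at hy
    obtain ⟨x, hx, hxy⟩ := H.exists_above y hy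
    have hne : x ≠ y := by rintro rfl; omega
    have hmul : stabSum c (signChar n) * MonoidAlgebra.single (Equiv.swap x y * g) 1 * stabSum r 1 =
        -(stabSum c (signChar n) * MonoidAlgebra.single g 1 * stabSum r 1) := by
      rw [← one_mul (1 : ℂ), ← MonoidAlgebra.single_mul_single, ← mul_assoc,
        stabSum_mul_swap hne hxy, neg_mul, neg_mul]
      simp
    by_cases hxg : x ∈ (secondRow r).map g.toEmbedding
    · obtain ⟨t, ht⟩ := ih _ (by
        rw [← hd]
        refine Finset.card_lt_card (Finset.ssubset_iff_of_subset ?_ |>.2 ⟨y, ?_, ?_⟩)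
        · intro z hz
          rw [Finset.mem_sdiff, mem_secondRow] at hz ⊢
          refine ⟨hz.1, fun hzg => hz.2 ?_⟩
          have h1 : z ≠ x := by rintro rfl; omega
          have h2 : z ≠ y := by rintro rfl; exact hyg hzg
          rw [hmem] at hzg
          rw [Finset.mem_map_equiv, mem_secondRow, ← Equiv.Perm.inv_def, mul_inv_rev,
            Equiv.swap_inv, Equiv.Perm.mul_apply, Equiv.swap_apply_of_ne_of_ne h1 h2, hzg]
        · rw [Finset.mem_sdiff, mem_secondRow]
          exact ⟨hy, hyg⟩
        · rw [Finset.mem_sdiff, not_and_not_right]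
          intro _
          rw [hmem] at hxg
          rw [Finset.mem_map_equiv, mem_secondRow, ← Equiv.Perm.inv_def, mul_inv_rev,
            Equiv.swap_inv, Equiv.Perm.mul_apply, Equiv.swap_apply_right, hxg])
        (Equiv.swap x y * g) rfl
      exact ⟨-t, by rw [neg_smul, ← ht, hmul, neg_neg]⟩
    · refine ⟨0, ?_⟩
      rw [zero_smul]
      rw [hmem] at hxg hyg
      have hs : MonoidAlgebra.single (Equiv.swap (g⁻¹ x) (g⁻¹ y)) (1 : ℂ) * stabSum r 1 =
          stabSum r 1 := single_mul_stabSum (χ := 1) fun z => by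
        rw [H.row_eq_iff, mem_secondRow, mem_secondRow, Equiv.swap_apply_def]
        split_ifs with h1 h2
        · subst h1; tauto
        · subst h2; tauto
        · rfl
      have hg : Equiv.swap x y * g = g * Equiv.swap (g⁻¹ x) (g⁻¹ y) := by
        rw [Equiv.mul_swap_eq_swap_mul]; simp
      rw [hg, ← one_mul (1 : ℂ), ← MonoidAlgebra.single_mul_single, mul_assoc, mul_assoc, hs,
        ← mul_assoc] at hmul
      rw [mul_one (1 : ℂ)] at hmul
      exact eq_zero_of_eq_neg hmul

theorem exists_mul_mul (x : GroupAlg n) :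
    ∃ t : ℂ, stabSum c (signChar n) * x * stabSum r 1 =
      t • (stabSum c (signChar n) * stabSum r 1) := by
  induction x using MonoidAlgebra.induction_linear with
  | zero => exact ⟨0, by simp⟩
  | add x y hx hy =>
    obtain ⟨s, hs⟩ := hx
    obtain ⟨t, ht⟩ := hy
    exact ⟨s + t, by rw [mul_add, add_mul, hs, ht, add_smul]⟩
  | single σ z =>
    obtain ⟨t, ht⟩ := H.exists_mul_single_mul σ
    refine ⟨z * t, ?_⟩
    have : (MonoidAlgebra.single σ z : GroupAlg n) = z • MonoidAlgebra.single σ 1 := by simp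
    rw [this, mul_smul_comm, smul_mul_assoc, ht, smul_smul]

/-- Two entries in a common column avoiding a set smaller than the second row. -/
theorem exists_column_avoiding {P : Finset (Fin n)} (hP : P.card < (secondRow r).card) :
    ∃ x y, x ≠ y ∧ c x = c y ∧ x ∉ P ∧ y ∉ P := by
  have hcard : ((secondRow r).image c).card = (secondRow r).card :=
    Finset.card_image_of_injOn fun x hx y hy hxy =>
      H.ext x y ((mem_secondRow.1 hx).trans (mem_secondRow.1 hy).symm) hxy
  obtain ⟨l, hl, hlP⟩ := Finset.exists_mem_notMem_of_card_lt_card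
    (s := P.image c) (t := (secondRow r).image c)
    (by have := Finset.card_image_le (s := P) (f := c); omega)
  obtain ⟨y, hy, rfl⟩ := Finset.mem_image.1 hl
  rw [mem_secondRow] at hy
  obtain ⟨x, hx, hxy⟩ := H.exists_above y hy
  refine ⟨x, y, by rintro rfl; omega, hxy, fun h => hlP ?_, fun h => hlP ?_⟩
  · rw [← hxy]; exact Finset.mem_image_of_mem c h
  · exact Finset.mem_image_of_mem c h

/-- A column-preserving permutation that moves an even number of entries of the second row to the
first row is even. -/
theorem signChar_eq_one {σ : Equiv.Perm (Fin n)} (hσ : ∀ x, c (σ x) = c x)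
    (he : Even (secondRow r \ (secondRow r).map σ.toEmbedding).card) : signChar n σ = 1 := by
  -- A column has at most two entries, so `σ` is an involution.
  have hinv : ∀ x, σ (σ x) = x := by
    intro x
    by_cases h : σ x = x
    · rw [h, h]
    · have h1 : r (σ x) ≠ r x := fun h' => h (H.ext _ _ h' (hσ x))
      have h2 : r (σ (σ x)) ≠ r (σ x) := fun h' => h (σ.injective (H.ext _ _ h' (hσ (σ x))))
      have := H.le_one x
      have := H.le_one (σ x)
      have := H.le_one (σ (σ x))
      exact H.ext _ _ (by omega) ((hσ _).trans (hσ x))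
  have hsymm : σ.symm = σ := by
    ext x; rw [(Equiv.symm_apply_eq σ).2 (hinv x).symm]
  -- Every moved point changes row. The two differences have equal size, so that size is the number
  -- of transpositions in `σ`.
  have hsupp : σ.support = (secondRow r \ (secondRow r).map σ.toEmbedding) ∪
      ((secondRow r).map σ.toEmbedding \ secondRow r) := by
    ext x
    rw [Finset.mem_union, Finset.mem_sdiff, Finset.mem_sdiff, Finset.mem_map_equiv, hsymm,
      Equiv.Perm.mem_support]
    have h1 : σ x = x ↔ r (σ x) = r x := ⟨fun h => by rw [h], fun h => H.ext _ _ h (hσ x)⟩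
    rw [ne_eq, h1, H.row_eq_iff]
    tauto
  have hcard : σ.support.card = 2 * (secondRow r \ (secondRow r).map σ.toEmbedding).card := by
    rw [hsupp, Finset.card_union_of_disjoint,
      Finset.card_sdiff_comm (s := secondRow r) (by rw [Finset.card_map]), two_mul]
    exact disjoint_sdiff_sdiff
  rw [signChar_apply, Equiv.Perm.sign_of_pow_two_eq_one (by ext x; simp [pow_two, hinv]),
    Equiv.Perm.card_fixedPoints, Nat.sub_sub_self σ.sum_cycleType_le, Equiv.Perm.sum_cycleType,
    hcard]
  simp [he.neg_one_pow]

end Algebra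

/-! ### The Young symmetrizer acting on the matching space -/

section Matching

variable {k : ℕ} {r c : Fin (2 * k) → ℕ} (H : TwoRowed r c)
include H

/-- A set smaller than the second row misses both entries of some column. Swapping them fixes the
set but negates the column sum. -/
theorem stabSum_smul_closedSpan {p : ℕ → Prop} (hp : ∀ i, p i → i < (secondRow r).card)
    {v : MatchingSpace k} (hv : v ∈ closedSpan k p) : stabSum c (signChar (2 * k)) • v = 0 := by
  rw [← Submodule.restrictScalars_mem ℂ, closedSpan_restrictScalars] at hv
  induction hv using Submodule.span_induction with
  | zero => rw [smul_zero]
  | add x y _ _ hx hy => rw [smul_add, hx, hy, add_zero]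
  | smul z x _ hx => rw [smul_comm, hx, smul_zero]
  | mem v hv =>
    obtain ⟨P, hP, rfl⟩ := hv
    obtain ⟨x, y, hne, hxy, hx, hy⟩ := H.exists_column_avoiding (hp _ hP)
    have hmap : P.map (Equiv.swap x y).toEmbedding = P := by
      ext z
      rw [Finset.mem_map_equiv, Equiv.symm_swap, Equiv.swap_apply_def]
      split_ifs with h1 h2
      · subst h1; tauto
      · subst h2; tauto
      · rfl
    have h := congrArg (· • closedVec P) (stabSum_mul_swap hne hxy)
    simp only [mul_smul, single_smul_closedVec, hmap, neg_smul] at h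
    exact eq_zero_of_eq_neg h

/-- Evaluate at a matching `M` in which the second row is closed. A term survives only if the image
of the second row is closed too; then their intersection is even, so the sign is 1. Nothing cancels,
and the identity contributes. -/
theorem stabSum_smul_closedVec_ne_zero (he : Even (secondRow r).card) :
    stabSum c (signChar (2 * k)) • closedVec (secondRow r) ≠ 0 := by
  obtain ⟨M, hM⟩ := exists_closed he
  intro h
  have h1 := congrFun (congrArg (matchingRep k).asModuleEquiv h) M
  rw [stabSum, Finset.sum_smul, map_sum, Finset.sum_apply, map_zero, Pi.zero_apply] at h1
  have h2 : ∀ σ ∈ Finset.univ.filter fun σ : Equiv.Perm (Fin (2 * k)) => ∀ x, c (σ x) = c x,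
      (matchingRep k).asModuleEquiv ((MonoidAlgebra.single σ (signChar (2 * k) σ) :
        GroupAlg (2 * k)) • closedVec (secondRow r)) M =
      if M.Closed ((secondRow r).map σ.toEmbedding) then 1 else 0 := by
    intro σ hσ
    have hσ := (Finset.mem_filter.1 hσ).2
    have : (MonoidAlgebra.single σ (signChar (2 * k) σ) : GroupAlg (2 * k)) =
      signChar (2 * k) σ • MonoidAlgebra.single σ 1 := by simp
    rw [this, smul_assoc, single_smul_closedVec, map_smul, Pi.smul_apply, closedVec_apply]
    split_ifs with hcl
    · rw [H.signChar_eq_one hσ, smul_eq_mul, one_mul]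
      have := Finset.card_sdiff_add_card_inter (secondRow r) ((secondRow r).map σ.toEmbedding)
      have h3 := (hM.inter hcl).even_card
      rw [← this] at he
      exact (Nat.even_add.1 he).2 h3
    · rw [smul_zero]
  rw [Finset.sum_congr rfl h2, ← Finset.sum_filter, Finset.sum_const, nsmul_eq_mul, mul_one,
    Nat.cast_eq_zero, Finset.card_eq_zero] at h1
  refine Finset.notMem_empty (1 : Equiv.Perm (Fin (2 * k))) (h1 ▸ ?_)
  rw [Finset.mem_filter, Finset.mem_filter]
  refine ⟨⟨Finset.mem_univ _, fun _ => rfl⟩, ?_⟩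
  convert hM
  exact Finset.map_refl

theorem stabSum_row_smul_invariant (v : MatchingSpace k) (σ : Equiv.Perm (Fin (2 * k)))
    (hσ : ∀ x, σ x ∈ secondRow r ↔ x ∈ secondRow r) :
    (MonoidAlgebra.single σ (1 : ℂ) : GroupAlg (2 * k)) • stabSum r 1 • v = stabSum r 1 • v := by
  rw [← mul_smul]
  congr 1
  exact single_mul_stabSum (χ := 1) fun x => (H.row_eq_iff _ _).2 (hσ x)

omit H in
theorem stabSum_row_smul_closedVec :
    ∃ z : ℂ, z ≠ 0 ∧ stabSum r 1 • closedVec (secondRow r) = z • closedVec (secondRow r) := by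
  refine ⟨((Finset.univ.filter fun σ : Equiv.Perm (Fin (2 * k)) => ∀ x, r (σ x) = r x).card : ℂ), ?_, ?_⟩
  · rw [Nat.cast_ne_zero, Finset.card_ne_zero]
    exact ⟨1, by simp⟩
  · rw [stabSum, Finset.sum_smul, Nat.cast_smul_eq_nsmul, ← Finset.sum_const]
    refine Finset.sum_congr rfl fun σ hσ => ?_
    rw [MonoidHom.one_apply, single_smul_closedVec]
    congr 1
    refine Finset.eq_of_subset_of_card_le ?_ (by rw [Finset.card_map])
    intro x hx
    obtain ⟨y, hy, rfl⟩ := Finset.mem_map.1 hx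
    rw [mem_secondRow] at hy ⊢
    exact ((Finset.mem_filter.1 hσ).2 y).trans hy

variable (hS : (secondRow r).card = 0 ∨ (secondRow r).card = 2 ∨ (secondRow r).card = 4)
include hS

theorem exists_smul_polytabloid (v : MatchingSpace k) : ∃ z : ℂ,
    stabSum r 1 • v - z • closedVec (secondRow r) ∈
      (closedSpan k fun i => i < (secondRow r).card ∧ Even i) ∧
    (stabSum c (signChar (2 * k)) * stabSum r 1) • v = z • polytabloid r c := by
  obtain ⟨z, hz⟩ := exists_sub_smul_mem_closedSpan hS (H.stabSum_row_smul_invariant v)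
  refine ⟨z, hz, ?_⟩
  have := H.stabSum_smul_closedSpan (fun i hi => hi.1) hz
  rw [smul_sub, sub_eq_zero] at this
  rw [mul_smul, this, smul_comm, polytabloid]

theorem polytabloid_ne_zero : polytabloid r c ≠ 0 :=
  H.stabSum_smul_closedVec_ne_zero (by rcases hS with h | h | h <;> rw [h] <;> decide)

/-- Nonvanishing comes from the Hermitian form, as `closedVec (secondRow r)` is an eigenvector of
the row sum. -/
theorem exists_smul_polytabloid_self : ∃ z : ℂ, z ≠ 0 ∧
    stabSum r 1 • polytabloid r c - z • closedVec (secondRow r) ∈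
      (closedSpan k fun i => i < (secondRow r).card ∧ Even i) ∧
    (stabSum c (signChar (2 * k)) * stabSum r 1) • polytabloid r c = z • polytabloid r c := by
  obtain ⟨z, hz, hz'⟩ := H.exists_smul_polytabloid hS (polytabloid r c)
  refine ⟨z, ?_, hz, hz'⟩
  rintro rfl
  obtain ⟨y, hy, hy'⟩ := stabSum_row_smul_closedVec (r := r)
  rw [zero_smul, mul_smul] at hz'
  exact stabSum_smul_stabSum_smul_stabSum_smul_ne_zero r c (fun _ => Or.inl rfl) signChar_eq_or hy hy'
    (H.polytabloid_ne_zero hS) hz'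

theorem isotypicComponent_eq :
    isotypicComponent (GroupAlg (2 * k)) (MatchingSpace k) (Submodule.span (GroupAlg (2 * k))
        {stabSum c (signChar (2 * k)) * stabSum r 1}) =
      Submodule.span (GroupAlg (2 * k)) {polytabloid r c} ∧
    IsSimpleModule (GroupAlg (2 * k)) (Submodule.span (GroupAlg (2 * k)) {polytabloid r c}) := by
  obtain ⟨z, hz, -, hz'⟩ := H.exists_smul_polytabloid_self hS
  refine isotypicComponent_span_eq hz (fun x => ?_) (H.polytabloid_ne_zero hS) hz' fun v => ?_
  -- Regroup `(b a) x (b a)` as `b (a x b) a`.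
  · obtain ⟨t, ht⟩ := H.exists_mul_mul (stabSum r 1 * x * stabSum c (signChar (2 * k)))
    exact ⟨t, by rw [← ht]; noncomm_ring⟩
  · obtain ⟨t, -, ht⟩ := H.exists_smul_polytabloid hS v
    exact ⟨t, ht⟩

theorem closedVec_mem_sup : closedVec (secondRow r) ∈
    Submodule.span (GroupAlg (2 * k)) {polytabloid r c} ⊔
      closedSpan k fun i => i < (secondRow r).card ∧ Even i := by
  obtain ⟨z, hz, hz', -⟩ := H.exists_smul_polytabloid_self hS
  have h1 : z • closedVec (secondRow r) ∈ Submodule.span (GroupAlg (2 * k)) {polytabloid r c} ⊔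
      closedSpan k fun i => i < (secondRow r).card ∧ Even i := by
    rw [← sub_sub_self (stabSum r 1 • polytabloid r c) (z • closedVec (secondRow r))]
    exact Submodule.sub_mem _ (Submodule.mem_sup_left (Submodule.smul_mem _ _
      (Submodule.mem_span_singleton_self _))) (Submodule.mem_sup_right hz')
  have h2 := Submodule.smul_of_tower_mem _ z⁻¹ h1
  rwa [smul_smul, inv_mul_cancel₀ hz, one_smul] at h2

/-- The column sum kills the span but scales the polytabloid by a nonzero factor. -/
theorem polytabloid_notMem_closedSpan {p : ℕ → Prop} (hp : ∀ i, p i → i < (secondRow r).card) :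
    polytabloid r c ∉ closedSpan k p := by
  intro h
  obtain ⟨β, hβ, hβ'⟩ := stabSum_mul_self c (signChar (2 * k))
  have h0 := H.stabSum_smul_closedSpan hp h
  rw [polytabloid, ← mul_smul, hβ', smul_assoc, smul_eq_zero] at h0
  exact h0.elim hβ (H.polytabloid_ne_zero hS)

end Matching

end TwoRowed

/-! ### Tableaux with at most two rows -/

section Tableau

variable {n j : ℕ} {μ : YoungDiagram}

theorem mem_oneRow (a : ℕ) (x : ℕ × ℕ) : x ∈ oneRow a ↔ x.1 = 0 ∧ x.2 < a := by
  obtain ⟨i, l⟩ := x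
  rw [oneRow, YoungDiagram.mem_ofRowLens]
  rcases i with _ | i <;> simp

theorem mem_twoRow (a b : ℕ) (h : b ≤ a) (x : ℕ × ℕ) :
    x ∈ twoRow a b h ↔ x.1 = 0 ∧ x.2 < a ∨ x.1 = 1 ∧ x.2 < b := by
  obtain ⟨i, l⟩ := x
  rw [twoRow, YoungDiagram.mem_ofRowLens]
  rcases i with _ | _ | i <;> simp

theorem twoRowed_tableau (hj : 2 * j ≤ n)
    (hμ : ∀ x, x ∈ μ ↔ x.1 = 0 ∧ x.2 < n - j ∨ x.1 = 1 ∧ x.2 < j) (T : Tableau n μ) :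
    TwoRowed (fun x => (T x).1.1) (fun x => (T x).1.2) where
  le_one x := by
    have := (hμ _).1 ((YoungDiagram.mem_cells _).1 (T x).2)
    omega
  ext x y h1 h2 := T.injective (Subtype.ext (Prod.ext h1 h2))
  exists_above y hy := by
    have := (hμ _).1 ((YoungDiagram.mem_cells _).1 (T y).2)
    refine ⟨T.symm ⟨(0, (T y).1.2), (YoungDiagram.mem_cells _).2 ((hμ _).2 (Or.inl ⟨rfl, ?_⟩))⟩, ?_, ?_⟩
    · change (T y).1.2 < n - j
      omega
    · simp
    · simp

theorem card_secondRow (hμ : ∀ x, x ∈ μ ↔ x.1 = 0 ∧ x.2 < n - j ∨ x.1 = 1 ∧ x.2 < j)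
    (T : Tableau n μ) : (secondRow fun x => (T x).1.1).card = j := by
  rw [← Finset.card_range j]
  refine Finset.card_bij (fun x _ => (T x).1.2) ?_ ?_ ?_
  · intro x hx
    rw [mem_secondRow] at hx
    have := (hμ _).1 ((YoungDiagram.mem_cells _).1 (T x).2)
    rw [Finset.mem_range]
    omega
  · intro x hx y hy h
    rw [mem_secondRow] at hx hy
    exact T.injective (Subtype.ext (Prod.ext (hx.trans hy.symm) h))
  · intro l hl
    refine ⟨T.symm ⟨(1, l), (YoungDiagram.mem_cells _).2 ((hμ _).2 (Or.inr ⟨rfl, by simpa using hl⟩))⟩, ?_, ?_⟩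
    · rw [mem_secondRow]; simp
    · simp

theorem nonempty_tableau (hj : 2 * j ≤ n)
    (hμ : ∀ x, x ∈ μ ↔ x.1 = 0 ∧ x.2 < n - j ∨ x.1 = 1 ∧ x.2 < j) : Nonempty (Tableau n μ) := by
  have : μ.cells = ({0} ×ˢ Finset.range (n - j)) ∪ ({1} ×ˢ Finset.range j) := by
    ext x
    rw [YoungDiagram.mem_cells, hμ]
    simp only [Finset.mem_union, Finset.mem_product, Finset.mem_singleton, Finset.mem_range]
  refine ⟨Fintype.equivOfCardEq ?_⟩
  rw [Fintype.card_fin, Fintype.card_coe, this, Finset.card_union_of_disjoint]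
  · simp; omega
  · rw [Finset.disjoint_left]
    intro x
    simp only [Finset.mem_product, Finset.mem_singleton, Finset.mem_range]
    omega

end Tableau

/-! ### The constituents -/

section Constituent

variable {k j : ℕ} {μ : YoungDiagram}

/-- Tableaux of one shape differ by a relabelling, so the submodule generated by the polytabloid
depends only on the shape. -/
theorem polytabloid_comp (r c : Fin (2 * k) → ℕ) (g : Equiv.Perm (Fin (2 * k))) :
    polytabloid (r ∘ g) (c ∘ g) =
      (MonoidAlgebra.single g⁻¹ 1 : GroupAlg (2 * k)) • polytabloid r c := by
  have h : secondRow r = (secondRow (r ∘ g)).map g.toEmbedding := by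
    ext x
    rw [Finset.mem_map_equiv, mem_secondRow, mem_secondRow, Function.comp_apply,
      Equiv.apply_symm_apply]
  rw [polytabloid, polytabloid, stabSum_comp g fun σ => by simp [signChar_apply, mul_right_comm], h,
    ← single_smul_closedVec, mul_smul, mul_smul]

theorem constituent_eq (hj : j = 0 ∨ j = 2 ∨ j = 4) (hjk : 2 * j ≤ 2 * k)
    (hμ : ∀ x, x ∈ μ ↔ x.1 = 0 ∧ x.2 < 2 * k - j ∨ x.1 = 1 ∧ x.2 < j) (T : Tableau (2 * k) μ) :
    constituent k μ = Submodule.span (GroupAlg (2 * k))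
      {polytabloid (fun x => (T x).1.1) (fun x => (T x).1.2)} := by
  have hiso : ∀ T : Tableau (2 * k) μ,
      isotypicComponent (GroupAlg (2 * k)) (MatchingSpace k) (specht T) =
      Submodule.span (GroupAlg (2 * k)) {polytabloid (fun x => (T x).1.1) (fun x => (T x).1.2)} :=
    fun T => ((twoRowed_tableau hjk hμ T).isotypicComponent_eq
      (by rw [card_secondRow hμ T]; exact hj)).1
  rw [constituent]
  refine le_antisymm (iSup_le fun T' => ?_) ((hiso T).symm.le.trans
    (le_iSup (fun T : Tableau (2 * k) μ =>
    isotypicComponent (GroupAlg (2 * k)) (MatchingSpace k) (specht T)) T))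
  rw [hiso, Submodule.span_singleton_le_iff_mem]
  have h := polytabloid_comp (fun x => (T x).1.1) (fun x => (T x).1.2) (T'.trans T.symm)
  have h1 : (fun x => (T x).1.1) ∘ (T'.trans T.symm) = fun x => (T' x).1.1 := by
    ext x; simp
  have h2 : (fun x => (T x).1.2) ∘ (T'.trans T.symm) = fun x => (T' x).1.2 := by
    ext x; simp
  rw [h1, h2] at h
  rw [h]
  exact Submodule.smul_mem _ _ (Submodule.mem_span_singleton_self _)

theorem closedSpan_eq_le {N : Submodule (GroupAlg (2 * k)) (MatchingSpace k)}
    {S : Finset (Fin (2 * k))} (hS : closedVec S ∈ N) : closedSpan k (· = S.card) ≤ N := by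
  refine closedSpan_le fun P hP => ?_
  let e : {x // x ∈ S} ≃ {x // x ∈ P} := Finset.equivOfCardEq hP.symm
  have : S.map e.extendSubtype.toEmbedding = P := by
    refine Finset.eq_of_subset_of_card_le ?_ (by rw [Finset.card_map, hP])
    intro x hx
    obtain ⟨y, hy, rfl⟩ := Finset.mem_map.1 hx
    exact e.extendSubtype_mem y hy
  rw [← this, ← single_smul_closedVec]
  exact N.smul_mem _ hS

/-- One step of the filtration: modulo smaller even sets, the `j`-set vectors span exactly the
constituent, which is a complement because it is simple and not contained in the smaller span. -/
theorem constituent_spec (hj : j = 0 ∨ j = 2 ∨ j = 4) (hjk : 2 * j ≤ 2 * k)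
    (hμ : ∀ x, x ∈ μ ↔ x.1 = 0 ∧ x.2 < 2 * k - j ∨ x.1 = 1 ∧ x.2 < j) :
    IsSimpleModule (GroupAlg (2 * k)) (constituent k μ) ∧
    constituent k μ ≤ closedSpan k (· = j) ∧
    closedSpan k (· = j) ≤ constituent k μ ⊔ closedSpan k (fun i => i < j ∧ Even i) ∧
    Disjoint (constituent k μ) (closedSpan k fun i => i < j ∧ Even i) := by
  obtain ⟨T⟩ := nonempty_tableau hjk hμ
  have H := twoRowed_tableau hjk hμ T
  have hc := card_secondRow hμ T
  have hS := hj
  rw [← hc] at hS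
  have hsimple := (H.isotypicComponent_eq hS).2
  rw [constituent_eq hj hjk hμ T]
  refine ⟨hsimple, ?_, ?_, ?_⟩
  · rw [Submodule.span_singleton_le_iff_mem]
    exact Submodule.smul_mem _ _ (closedVec_mem_closedSpan hc)
  · have := closedSpan_eq_le (H.closedVec_mem_sup hS)
    rwa [hc] at this
  · have hatom := isSimpleModule_iff_isAtom.1 hsimple
    refine hatom.not_le_iff_disjoint.1 fun h => ?_
    refine H.polytabloid_notMem_closedSpan hS (p := fun i => i < j ∧ Even i)
      (fun i hi => by rw [hc]; exact hi.1) ?_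
    exact h (Submodule.mem_span_singleton_self _)

/-- The sum of the vectors of the four-element sets containing `P`. -/
noncomputable def sumFour (P : Finset (Fin (2 * k))) : MatchingSpace k :=
  ∑ S ∈ Finset.univ.filter fun S : Finset (Fin (2 * k)) => S.card = 4 ∧ P ⊆ S, closedVec S

theorem sumFour_mem (P : Finset (Fin (2 * k))) : sumFour P ∈ closedSpan k (· = 4) :=
  Submodule.sum_mem _ fun _ hS => closedVec_mem_closedSpan (Finset.mem_filter.1 hS).2.1

theorem sumFour_apply (P : Finset (Fin (2 * k))) (M : PerfMatching k) :
    (matchingRep k).asModuleEquiv (sumFour P) M =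
      ((Finset.univ.filter fun S : Finset (Fin (2 * k)) =>
        (S.card = 4 ∧ P ⊆ S) ∧ M.Closed S).card : ℂ) := by
  rw [sumFour, map_sum, Finset.sum_apply]
  simp_rw [closedVec_apply]
  rw [← Finset.sum_filter, Finset.sum_const, Finset.filter_filter, nsmul_eq_mul, mul_one]

theorem single_smul_sumFour {P : Finset (Fin (2 * k))} {σ : Equiv.Perm (Fin (2 * k))}
    (hσ : ∀ x, σ x ∈ P ↔ x ∈ P) :
    (MonoidAlgebra.single σ (1 : ℂ) : GroupAlg (2 * k)) • sumFour P = sumFour P := by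
  rw [sumFour, Finset.smul_sum]
  refine Finset.sum_equiv (Equiv.finsetCongr σ) ?_ ?_
  · intro S
    simp only [Finset.mem_filter, Finset.mem_univ, true_and, Equiv.finsetCongr_apply,
      Finset.card_map]
    refine and_congr_right fun _ => ⟨fun h x hx => ?_, fun h x hx => ?_⟩
    · rw [Finset.mem_map_equiv]
      exact h ((hσ _).1 (by rwa [Equiv.apply_symm_apply]))
    · simpa using h ((hσ x).2 hx)
  · intro S _
    rw [single_smul_closedVec, Equiv.finsetCongr_apply]

/-- The sum over all four-sets is invariant, hence a multiple of the all-ones vector. The multiple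
is nonzero because some four-set is closed for some matching. -/
theorem closedSpan_zero_le (hk : 4 ≤ k) : closedSpan k (· = 0) ≤ closedSpan k (· = 4) := by
  obtain ⟨z, hz⟩ := exists_sub_smul_mem_closedSpan (S := (∅ : Finset (Fin (2 * k)))) (Or.inl rfl)
    (fun σ hσ => single_smul_sumFour (P := ∅) hσ)
  have h0 : (closedSpan k fun i => i < (∅ : Finset (Fin (2 * k))).card ∧ Even i) = ⊥ :=
    eq_bot_iff.2 (closedSpan_le fun P hP => by simp at hP)
  rw [h0, Submodule.mem_bot, sub_eq_zero] at hz
  have hz0 : z ≠ 0 := by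
    rintro rfl
    obtain ⟨S, hS⟩ := Finset.exists_subset_card_eq
      (show 4 ≤ (Finset.univ : Finset (Fin (2 * k))).card by simp; omega)
    obtain ⟨M, hM⟩ := exists_closed (P := S) (by rw [hS.2]; decide)
    have h := congrFun (congrArg (matchingRep k).asModuleEquiv hz) M
    rw [sumFour_apply, zero_smul, map_zero, Pi.zero_apply, Nat.cast_eq_zero,
      Finset.card_eq_zero] at h
    exact Finset.notMem_empty S (h ▸ by simp [hS, hM])
  have := closedSpan_eq_le (S := (∅ : Finset (Fin (2 * k)))) (N := closedSpan k (· = 4)) (by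
    have h1 := Submodule.smul_of_tower_mem _ z⁻¹ (sumFour_mem (∅ : Finset (Fin (2 * k))))
    rwa [hz, smul_smul, inv_mul_cancel₀ hz0, one_smul] at h1)
  simpa using this

/-- Two four-element sets that are closed for `M` and contain a given edge. -/
theorem one_lt_card_closed (hk : 4 ≤ k) {P : Finset (Fin (2 * k))} (hP : P.card = 2)
    {M : PerfMatching k} (hM : M.Closed P) :
    1 < (Finset.univ.filter fun S : Finset (Fin (2 * k)) =>
        (S.card = 4 ∧ P ⊆ S) ∧ M.Closed S).card := by
  have key : ∀ z ∉ P, ((P ∪ {z, M.partner z}).card = 4 ∧ P ⊆ P ∪ {z, M.partner z}) ∧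
      M.Closed (P ∪ {z, M.partner z}) := by
    intro z hz
    have hz' : M.partner z ∉ P := fun h => hz (M.partner_involutive z ▸ hM _ h)
    refine ⟨⟨?_, Finset.subset_union_left⟩, ?_⟩
    · rw [Finset.card_union_of_disjoint, hP, Finset.card_pair (M.partner_ne z).symm]
      rw [Finset.disjoint_right]
      intro x hx
      simp only [Finset.mem_insert, Finset.mem_singleton] at hx
      rcases hx with rfl | rfl <;> assumption
    · intro x hx
      rw [Finset.mem_union] at hx ⊢
      exact hx.imp (hM x) ((M.closed_pair (M.partner_ne z).symm).2 rfl x)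
  have huniv : (Finset.univ : Finset (Fin (2 * k))).card = 2 * k := by simp
  obtain ⟨z, -, hz⟩ := Finset.exists_mem_notMem_of_card_lt_card (s := P) (t := Finset.univ)
    (by omega)
  have hz4 := (key z hz).1.1
  obtain ⟨y, -, hy⟩ := Finset.exists_mem_notMem_of_card_lt_card (s := P ∪ {z, M.partner z})
    (t := Finset.univ) (by omega)
  have hyP : y ∉ P := fun h => hy (Finset.mem_union_left _ h)
  rw [Finset.one_lt_card]
  refine ⟨_, Finset.mem_filter.2 ⟨Finset.mem_univ _, key z hz⟩, _,
    Finset.mem_filter.2 ⟨Finset.mem_univ _, key y hyP⟩, fun h => hy ?_⟩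
  rw [h]
  simp

/-- A closed set containing `x` and `y` contains their partners, which already makes four points. -/
theorem card_closed_le_one {x y : Fin (2 * k)} (hxy : x ≠ y) {M : PerfMatching k}
    (hM : M.partner x ≠ y) :
    (Finset.univ.filter fun S : Finset (Fin (2 * k)) =>
        (S.card = 4 ∧ {x, y} ⊆ S) ∧ M.Closed S).card ≤ 1 := by
  have key : ∀ S : Finset (Fin (2 * k)), S.card = 4 → {x, y} ⊆ S → M.Closed S →
      S = {x, y, M.partner x, M.partner y} := by
    intro S hS hP hcl
    have hx : x ∈ S := hP (by simp)
    have hy : y ∈ S := hP (by simp)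
    symm
    apply Finset.eq_of_subset_of_card_le
    · intro z hz
      simp only [Finset.mem_insert, Finset.mem_singleton] at hz
      rcases hz with rfl | rfl | rfl | rfl
      exacts [hx, hy, hcl _ hx, hcl _ hy]
    · have h1 := M.partner_ne x
      have h2 := M.partner_ne y
      have h3 := M.partner_involutive.injective.ne hxy
      have h4 : x ≠ M.partner y := fun h => hM (by rw [h, M.partner_involutive])
      rw [hS, Finset.card_insert_of_notMem, Finset.card_insert_of_notMem, Finset.card_pair h3]
      · simp [h2.symm, hM.symm]
      · simp [hxy, h1.symm, h4]
  rw [Finset.card_le_one]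
  intro S hS S' hS'
  rw [Finset.mem_filter] at hS hS'
  rw [key S hS.2.1.1 hS.2.1.2 hS.2.2, key S' hS'.2.1.1 hS'.2.1.2 hS'.2.2]

theorem closedSpan_two_le (hk : 4 ≤ k) : closedSpan k (· = 2) ≤ closedSpan k (· = 4) := by
  let x : Fin (2 * k) := ⟨0, by omega⟩
  let y : Fin (2 * k) := ⟨1, by omega⟩
  let p : Fin (2 * k) := ⟨2, by omega⟩
  have hxy : x ≠ y := by simp [x, y]
  have hxp : x ≠ p := by simp [x, p]
  have hyp : p ≠ y := by simp [y, p]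
  have hcard : ({x, y} : Finset (Fin (2 * k))).card = 2 := Finset.card_pair hxy
  obtain ⟨z, hz⟩ := exists_sub_smul_mem_closedSpan (S := {x, y}) (Or.inr (Or.inl hcard))
    (fun σ hσ => single_smul_sumFour (P := {x, y}) hσ)
  have hle : (closedSpan k fun i => i < ({x, y} : Finset (Fin (2 * k))).card ∧ Even i) ≤
      closedSpan k (· = 0) := closedSpan_mono fun i hi => by
    obtain ⟨h, c, rfl⟩ := hi
    omega
  have hz := hle hz
  -- If `z = 0`, then `sumFour {x, y}` is constant. But it is at least 2 on a matching containing
  -- the edge `{x, y}`, and at most 1 on one that joins `x` to `p` instead.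
  have hz0 : z ≠ 0 := by
    rintro rfl
    rw [zero_smul, sub_zero, ← Submodule.restrictScalars_mem ℂ, closedSpan_restrictScalars] at hz
    have hset : {v : MatchingSpace k | ∃ P : Finset (Fin (2 * k)), P.card = 0 ∧ v = closedVec P} =
        {closedVec ∅} := by
      ext v; simp
    rw [hset, Submodule.mem_span_singleton] at hz
    obtain ⟨t, ht⟩ := hz
    have hconst : ∀ M, (matchingRep k).asModuleEquiv (sumFour {x, y}) M = t := by
      intro M
      rw [← ht, map_smul, Pi.smul_apply, closedVec_apply, if_pos M.closed_empty, smul_eq_mul,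
        mul_one]
    obtain ⟨M, hM⟩ := exists_closed (P := {x, y}) (by rw [hcard]; decide)
    obtain ⟨M', hM'⟩ := exists_closed (P := {x, p}) (by rw [Finset.card_pair hxp]; decide)
    have h1 := one_lt_card_closed hk hcard hM
    have h2 := card_closed_le_one hxy (M := M') (by rwa [(M'.closed_pair hxp).1 hM'])
    have h3 := (hconst M).trans (hconst M').symm
    rw [sumFour_apply, sumFour_apply, Nat.cast_inj] at h3
    omega
  have := closedSpan_eq_le (S := {x, y}) (N := closedSpan k (· = 4)) (by
    have h1 := Submodule.sub_mem _ (sumFour_mem {x, y}) (closedSpan_zero_le hk hz)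
    rw [sub_sub_cancel] at h1
    have h2 := Submodule.smul_of_tower_mem _ z⁻¹ h1
    rwa [smul_smul, inv_mul_cancel₀ hz0, one_smul] at h2)
  rwa [hcard] at this

end Constituent

end SymModule

/-! ### Assembling the filtration -/

theorem mainTheorem7 (k : ℕ) (hk : 4 ≤ k) :
    let U : Fin 3 → Submodule (SymModule.GroupAlg (2 * k)) (SymModule.MatchingSpace k) :=
      ![SymModule.constituent k (SymModule.oneRow (2 * k)),
        SymModule.constituent k (SymModule.twoRow (2 * k - 2) 2 (by omega)),
        SymModule.constituent k (SymModule.twoRow (2 * k - 4) 4 (by omega))]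
    -- the three modules are irreducible and their sum is direct
    (∀ i, IsSimpleModule (SymModule.GroupAlg (2 * k)) (U i)) ∧ iSupIndep U ∧
    -- the vectors `w_S` span it
    Submodule.span ℂ {v : SymModule.MatchingSpace k |
        ∃ S : Finset (Fin (2 * k)), S.card = 4 ∧ v = SymModule.w S} =
      (⨆ i, U i).restrictScalars ℂ := by
  open SymModule in
  intro U
  obtain ⟨s0, a0, b0, d0⟩ := constituent_spec (k := k) (j := 0) (μ := oneRow (2 * k)) (by simp)
    (by omega) (fun x => by rw [mem_oneRow]; simp)
  obtain ⟨s2, a2, b2, d2⟩ := constituent_spec (k := k) (j := 2)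
    (μ := twoRow (2 * k - 2) 2 (by omega)) (by simp) (by omega) (mem_twoRow _ _ _)
  obtain ⟨s4, a4, b4, d4⟩ := constituent_spec (k := k) (j := 4)
    (μ := twoRow (2 * k - 4) 4 (by omega)) (by simp) (by omega) (mem_twoRow _ _ _)
  set U0 := constituent k (oneRow (2 * k))
  set U2 := constituent k (twoRow (2 * k - 2) 2 (by omega))
  set U4 := constituent k (twoRow (2 * k - 4) 4 (by omega))
  have l0 : (closedSpan k fun i => i < 0 ∧ Even i) = ⊥ :=
    eq_bot_iff.2 (closedSpan_le fun P hP => absurd hP.1 (Nat.not_lt_zero _))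
  rw [l0, sup_bot_eq] at b0
  have l2 : (closedSpan k fun i => i < 2 ∧ Even i) ≤ U0 :=
    (closedSpan_mono fun i ⟨h, c, hc⟩ => by omega).trans b0
  have l4 : (closedSpan k fun i => i < 4 ∧ Even i) ≤ U0 ⊔ U2 := by
    refine closedSpan_le fun P ⟨h, c, hc⟩ => ?_
    rcases (by omega : P.card = 0 ∨ P.card = 2) with h | h
    · exact Submodule.mem_sup_left (b0 (closedVec_mem_closedSpan h))
    · exact (b2.trans (sup_comm U0 U2 ▸ sup_le_sup_left l2 _)) (closedVec_mem_closedSpan h)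
  -- Each constituent lies in the span that the next ones avoid; in a modular lattice these two
  -- disjointness facts give independence of all three.
  have e20 : Disjoint U2 U0 := d2.mono_right (a0.trans (closedSpan_mono fun i hi => by subst hi; decide))
  have e4 : Disjoint U4 (U0 ⊔ U2) := d4.mono_right (sup_le
    (a0.trans (closedSpan_mono fun i hi => by subst hi; decide))
    (a2.trans (closedSpan_mono fun i hi => by subst hi; decide)))
  have hsup : ⨆ i, U i = U0 ⊔ U2 ⊔ U4 := by
    refine le_antisymm (iSup_le fun i => ?_) (sup_le (sup_le (le_iSup U 0) (le_iSup U 1)) (le_iSup U 2))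
    fin_cases i
    · exact le_sup_left.trans le_sup_left
    · exact le_sup_right.trans le_sup_left
    · exact le_sup_right
  refine ⟨fun i => ?_, fun i => ?_, ?_⟩
  · fin_cases i
    exacts [s0, s2, s4]
  · have hle : ∀ N, (∀ i' : Fin 3, i' ≠ i → U i' ≤ N) → Disjoint (U i) N →
        Disjoint (U i) (⨆ i', ⨆ (_ : i' ≠ i), U i') := fun N h1 h2 =>
      h2.mono_right (iSup_le fun i' => iSup_le fun h => h1 i' h)
    fin_cases i
    · refine hle (U2 ⊔ U4) (fun i' hi' => ?_) ?_
      · fin_cases i'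
        exacts [absurd rfl hi', le_sup_left, le_sup_right]
      · exact e20.symm.disjoint_sup_right_of_disjoint_sup_left e4.symm
    · refine hle (U0 ⊔ U4) (fun i' hi' => ?_) ?_
      · fin_cases i'
        exacts [le_sup_left, absurd rfl hi', le_sup_right]
      · refine e20.disjoint_sup_right_of_disjoint_sup_left ?_
        rw [sup_comm]
        exact e4.symm
    · refine hle (U0 ⊔ U2) (fun i' hi' => ?_) e4
      fin_cases i'
      exacts [le_sup_left, le_sup_right, absurd rfl hi']
  · have hw : {v : MatchingSpace k | ∃ S : Finset (Fin (2 * k)), S.card = 4 ∧ v = w S} =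
        {v | ∃ S : Finset (Fin (2 * k)), S.card = 4 ∧ v = closedVec S} :=
      Set.ext fun v => exists_congr fun S => and_congr_right fun h => by rw [w_eq_closedVec h]
    rw [hw, ← closedSpan_restrictScalars (· = 4), hsup]
    congr 1
    refine le_antisymm (b4.trans ?_) (sup_le (sup_le (a0.trans (closedSpan_zero_le hk))
      (a2.trans (closedSpan_two_le hk))) a4)
    rw [sup_comm _ U4]
    exact sup_le_sup_left l4 _
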